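/- **Proposition 4.3.** Let $(G,d)$ be a compact metric group, i.e. a group $G$ with identity $e$ and a metric $d$ satisfying $d(gx,gy)=d(x,y)=d(xg,yg)$ for all $g,x,y\in G$, such that $(G,d)$ is compact. *Quantum metric spaces.* An order-unit space is a real ordered vector space $A$ with an element $1$ such that every $a\in A$ satisfies $a\le r1$ for some $r\in\mathbb R$, and $a\le 0$ whenever $a\le r1$ for all $r>0$. An order-unit morphism is a linear map preserving the order and the unit; a state is an order-unit morphism to $\mathbb R$, and $S(A)$ is the set of states. A Lip-norm on $A$ is a (finite) seminorm $L$ such that $L(a)=0$ iff $a\in\mathbb R1$, and such that $d_L(\sigma,\tau)=\sup\{|\sigma(a)-\tau(a)|: L(a)\le 1\}$ is a metric on $S(A)$ inducing the weak$^*$ topology. Then $(A,L)$ is called a quantum metric space, and $S(A,L)=(S(A),d_L)$ is a compact metric space. A morphism $(A,L_A)\to(B,L_B)$ of quantum metric spaces is an order-unit morphism $\phi$ with $L_B(\phi(a))\le L_A(a)$ for all $a\in A$. *The group and its truncations.* Let $\mathcal A$ be the order-unit space of real-valued Lipschitz functions on $G$ (with the pointwise order and the constant function $1$) and let $L(f)$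 be the lowest Lipschitz constant of $f$. Let $L^2(G)$ be the complex $L^2$-space of the normalized Haar measure, on which $\mathcal A$ acts by multiplication, and put $(U_g\psi)(x)=\psi(g^{-1}x)$, $(V_g\psi)(x)=\psi(xg)$, $\lambda_g(T)=U_gTU_g^*$, $\rho_g(T)=V_gTV_g^*$ for bounded operators $T$ on $L^2(G)$, and $$\|T\|_\lambda=\sup_{x\ne y}\frac{\|\lambda_x(T)-\lambda_y(T)\|}{d(x,y)},\qquad \|T\|_\rho=\sup_{x\ne y}\frac{\|\rho_x(T)-\rho_y(T)\|}{d(x,y)}.$$ Let $\widehat G$ be the set of equivalence classes of irreducible unitary representations of $G$. For a finite subset $\Lambda\subseteq\widehat G$ let $P_\Lambda$ be the orthogonal projection of $L^2(G)$ onto $L^2(G)_\Lambda=\bigoplus_{\nu\in\Lambda}E_\nu\otimes E_\nu^*$, where $E_\nu$ is the space of $\nu$ and $E_\nu\otimes E_\nu^*$ is identified with the span of the matrix coefficients $x\mapsto\varphi(\nu(x^{-1})v)$, $v\in E_\nu$, $\varphi\in E_\nu^*$. Put $\tau_\Lambda(f)=P_\Lambda fP_\Lambda$ for $f\in\mathcal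 A$, and $\mathcal A_\Lambda=\tau_\Lambda(\mathcal A)$, with the order of self-adjoint operators and the unit $P_\Lambda$; it is preserved by every $\rho_g$. Let $L_\Lambda(T)=\max(\|T\|_\lambda,\|T\|_\rho)$ for $T\in\mathcal A_\Lambda$. *Claim.* Let $\Lambda\subseteq\widehat G$ be finite, and let $\mu$ be a Borel probability measure on $G$ that is liftable to a state on $\mathcal A_\Lambda$, i.e. there is a (necessarily unique) state $\mu_\Lambda\in S(\mathcal A_\Lambda)$ with $\mu_\Lambda(\tau_\Lambda(f))=\int_G f\,d\mu$ for all $f\in\mathcal A$. Then $(\mathcal A_\Lambda,L_\Lambda)$ and $(\mathcal A,L)$ are quantum metric spaces with nonempty state spaces, the formula $$\upsilon_\Lambda^\mu(T)(g)=\mu_\Lambda(\rho_g(T)),\qquad T\in\mathcal A_\Lambda,\ g\in G,$$ defines a morphism of quantum metric spaces $\upsilon_\Lambda^\mu:(\mathcal A_\Lambda,L_\Lambda)\to(\mathcal A,L)$, and the Gromov–Hausdorff distance satisfies $$d_{GH}\big(S(\mathcal A_\Lambda,L_\Lambda),S(\mathcal A,L)\big)\le\int_G d(e,x)\,d\mu(x).$$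 -/

import Mathlib

open MeasureTheory
open scoped ENNReal NNReal

universe u

noncomputable section

/-! ### Order-unit spaces and their states -/

/-- A real ordered vector space whose element `1` is an archimedean order unit. -/
class OrderUnitSpace (A : Type*) [AddCommGroup A] [PartialOrder A] [Module ℝ A] [One A] : Prop
    extends IsOrderedAddMonoid A, IsOrderedModule ℝ A where
  exists_le_smul_one : ∀ a : A, ∃ r : ℝ, a ≤ r • (1 : A)
  le_zero_of_forall_le_smul_one : ∀ a : A, (∀ r : ℝ, 0 < r → a ≤ r • (1 : A)) → a ≤ 0

/-- Order-unit morphisms: linear maps that preserve the order and the unit. -/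
structure OrderUnitHom (A B : Type*) [AddCommGroup A] [PartialOrder A] [Module ℝ A] [One A]
    [AddCommGroup B] [PartialOrder B] [Module ℝ B] [One B] extends A →ₚ[ℝ] B where
  map_one' : toFun 1 = 1

instance {A B : Type*} [AddCommGroup A] [PartialOrder A] [Module ℝ A] [One A]
    [AddCommGroup B] [PartialOrder B] [Module ℝ B] [One B] :
    FunLike (OrderUnitHom A B) A B where
  coe φ := φ.toFun
  coe_injective φ ψ h := by
    rcases φ with ⟨φ, h₁⟩
    rcases ψ with ⟨ψ, h₂⟩
    congr
    exact DFunLike.coe_injective h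

section States

variable {A : Type*} [AddCommGroup A] [PartialOrder A] [Module ℝ A] [One A]

/-- States on `A`: order-unit morphisms `A → ℝ`. -/
abbrev State (A : Type*) [AddCommGroup A] [PartialOrder A] [Module ℝ A] [One A] : Type _ :=
  OrderUnitHom A ℝ

/-- The weak-* topology on the states: pointwise convergence on `A`. -/
instance State.instTopologicalSpace : TopologicalSpace (State A) :=
  TopologicalSpace.induced (fun (σ : State A) (a : A) => σ a) Pi.topologicalSpace

/-- The state space of an order-unit space is weak-* compact. -/
theorem State.compactSpace [OrderUnitSpace A] : CompactSpace (State A) := by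
  have hind : Topology.IsInducing (fun (σ : State A) (a : A) => σ a) := ⟨rfl⟩
  choose r hr using OrderUnitSpace.exists_le_smul_one (A := A)
  have hone : ∀ σ : State A, σ 1 = 1 := fun σ => σ.map_one'
  have hsmul : ∀ (σ : State A) (c : ℝ) (a : A), σ (c • a) = c * σ a :=
    fun σ c a => σ.map_smul' c a
  have hmono : ∀ (σ : State A) {a b : A}, a ≤ b → σ a ≤ σ b := fun σ _ _ h => σ.monotone' h
  have hle : ∀ (σ : State A) (a : A), σ a ≤ r a := fun σ a => by
    simpa [hsmul, hone] using hmono σ (hr a)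
  have hneg : ∀ (σ : State A) (a : A), σ (-a) = - σ a := fun σ a => by
    simpa using hsmul σ (-1) a
  rw [← isCompact_univ_iff, hind.isCompact_iff, Set.image_univ]
  refine IsCompact.of_isClosed_subset
    (isCompact_univ_pi fun a : A => isCompact_Icc (a := -r (-a)) (b := r a)) ?_ ?_
  · have : Set.range (fun (σ : State A) (a : A) => σ a) =
        {f : A → ℝ | (∀ a b, f (a + b) = f a + f b) ∧ (∀ (c : ℝ) a, f (c • a) = c * f a) ∧
          (∀ a b, a ≤ b → f a ≤ f b) ∧ f 1 = 1} := by
      ext f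
      constructor
      · rintro ⟨σ, rfl⟩
        exact ⟨σ.map_add', hsmul σ, fun a b h => hmono σ h, hone σ⟩
      · rintro ⟨h1, h2, h3, h4⟩
        exact ⟨⟨⟨⟨⟨f, h1⟩, h2⟩, fun a b h => h3 a b h⟩, h4⟩, rfl⟩
    rw [this]
    simp only [Set.ofPred_and, Set.ofPred_forall]
    refine ((isClosed_iInter fun a => isClosed_iInter fun b => ?_).inter
      ((isClosed_iInter fun c => isClosed_iInter fun a => ?_).inter
      ((isClosed_iInter fun a => isClosed_iInter fun b => isClosed_iInter fun _ => ?_).inter ?_)))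
    · exact isClosed_eq (by fun_prop) (by fun_prop)
    · exact isClosed_eq (by fun_prop) (by fun_prop)
    · exact isClosed_le (by fun_prop) (by fun_prop)
    · exact isClosed_eq (by fun_prop) (by fun_prop)
  · rintro _ ⟨σ, rfl⟩ a -
    have := hle σ (-a)
    rw [hneg] at this
    exact ⟨by linarith, hle σ a⟩

/-! ### Lip-norms and quantum metric spaces -/

/-- `d_L(σ, τ) = sup {|σ(a) - τ(a)| : L(a) ≤ 1}`, as an extended real number. -/
def lipEDist (L : A → ℝ≥0∞) (σ τ : State A) : ℝ≥0∞ :=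
  ⨆ (a : A) (_ : L a ≤ 1), ENNReal.ofReal |σ a - τ a|

/-- `L` is a Lip-norm: a (finite) seminorm that vanishes exactly on the multiples of the unit and
such that `d_L` is a metric on the states which induces the weak-* topology. -/
structure IsLipNorm (L : A → ℝ≥0∞) : Prop where
  ne_top : ∀ a, L a ≠ ∞
  add_le : ∀ a b, L (a + b) ≤ L a + L b
  smul_eq : ∀ (r : ℝ) (a : A), L (r • a) = ENNReal.ofReal |r| * L a
  eq_zero_iff : ∀ a, L a = 0 ↔ ∃ r : ℝ, a = r • (1 : A)
  metrizes : ∃ m : MetricSpace (State A),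
    (∀ σ τ : State A, m.edist σ τ = lipEDist L σ τ) ∧
      m.toUniformSpace.toTopologicalSpace = State.instTopologicalSpace

/-- The pair `(A, L)` is a quantum metric space. -/
structure IsQuantumMetricSpace (L : A → ℝ≥0∞) : Prop where
  orderUnitSpace : OrderUnitSpace A
  isLipNorm : IsLipNorm L

/-- The metric space `S(A, L) = (S(A), d_L)`. -/
def StateSpace {L : A → ℝ≥0∞} (_ : IsQuantumMetricSpace L) : Type _ := State A

instance {L : A → ℝ≥0∞} (h : IsQuantumMetricSpace L) : MetricSpace (StateSpace h) :=
  h.isLipNorm.metrizes.choose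

instance {L : A → ℝ≥0∞} (h : IsQuantumMetricSpace L) : CompactSpace (StateSpace h) := by
  have := h.orderUnitSpace
  have hc : CompactSpace (State A) := State.compactSpace
  have ht := h.isLipNorm.metrizes.choose_spec.2
  rw [← ht] at hc
  exact hc

instance {L : A → ℝ≥0∞} (h : IsQuantumMetricSpace L) [hne : Nonempty (State A)] :
    Nonempty (StateSpace h) := hne

end States

/-- Morphisms of quantum metric spaces: order-unit morphisms that do not increase the Lip-norm. -/
def OrderUnitHom.IsLipMorphism {A B : Type*} [AddCommGroup A] [PartialOrder A] [Module ℝ A] [One A]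
    [AddCommGroup B] [PartialOrder B] [Module ℝ B] [One B] (φ : OrderUnitHom A B)
    (LA : A → ℝ≥0∞) (LB : B → ℝ≥0∞) : Prop :=
  ∀ a, LB (φ a) ≤ LA a

/-! ### The unitary dual of a topological group -/

section Dual

/-- A (topologically) irreducible, strongly continuous unitary representation of `G` on a complex
Hilbert space. -/
structure UnitaryIrrep (G : Type u) [Group G] [TopologicalSpace G] : Type (u + 1) where
  E : Type u
  [instNormedAddCommGroup : NormedAddCommGroup E]
  [instInnerProductSpace : InnerProductSpace ℂ E]
  [instCompleteSpace : CompleteSpace E]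
  rep : G →* unitary (E →L[ℂ] E)
  continuous_rep : ∀ v : E, Continuous fun g => (rep g : E →L[ℂ] E) v
  nontrivial : Nontrivial E
  irreducible : ∀ W : Submodule ℂ E, IsClosed (W : Set E) →
    (∀ g, ∀ v ∈ W, (rep g : E →L[ℂ] E) v ∈ W) → W = ⊥ ∨ W = ⊤

attribute [instance] UnitaryIrrep.instNormedAddCommGroup UnitaryIrrep.instInnerProductSpace
  UnitaryIrrep.instCompleteSpace

variable (G : Type u) [Group G] [TopologicalSpace G]

/-- Unitary equivalence of irreducible unitary representations. -/
instance UnitaryIrrep.instSetoid : Setoid (UnitaryIrrep G) where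
  r π π' := ∃ e : π.E ≃ₗᵢ[ℂ] π'.E, ∀ (g : G) (v : π.E),
    e ((π.rep g : π.E →L[ℂ] π.E) v) = (π'.rep g : π'.E →L[ℂ] π'.E) (e v)
  iseqv :=
    { refl := fun π => ⟨LinearIsometryEquiv.refl ℂ π.E, fun _ _ => rfl⟩
      symm := fun {π π'} ⟨e, he⟩ => ⟨e.symm, fun g v => by
        apply e.injective
        rw [he]
        simp⟩
      trans := fun {π π' π''} ⟨e, he⟩ ⟨e', he'⟩ => ⟨e.trans e', fun g v => by
        simp [he, he']⟩ }

/-- The unitary dual `Ĝ`: equivalence classes of irreducible unitary representations. -/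
def UnitaryDual : Type (u + 1) := Quotient (UnitaryIrrep.instSetoid G)

end Dual

/-! ### Compact groups with a bi-invariant metric -/

section MetricGroup

variable {G : Type u} [Group G] [MetricSpace G] [IsIsometricSMul G G] [IsIsometricSMul Gᵐᵒᵖ G]

instance metricGroup_isTopologicalGroup : IsTopologicalGroup G where
  continuous_mul := by
    have h : LipschitzWith 2 (fun p : G × G => p.1 * p.2) := by
      refine LipschitzWith.of_dist_le_mul fun p q => ?_
      calc dist (p.1 * p.2) (q.1 * q.2)
          ≤ dist (p.1 * p.2) (q.1 * p.2) + dist (q.1 * p.2) (q.1 * q.2) := dist_triangle _ _ _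
        _ = dist p.1 q.1 + dist p.2 q.2 := by rw [dist_mul_right, dist_mul_left]
        _ ≤ dist p q + dist p q := add_le_add (le_max_left _ _) (le_max_right _ _)
        _ = ((2 : ℝ≥0) : ℝ) * dist p q := by push_cast; ring
    exact h.continuous
  continuous_inv :=
    (Isometry.of_dist_eq fun x y : G => dist_inv_inv x y).continuous

variable (G) in
/-- The algebra of real-valued Lipschitz functions on `G`, as a subspace of `C(G, ℝ)`. -/
def LipAlg : Submodule ℝ C(G, ℝ) where
  carrier := {f | ∃ K : ℝ≥0, LipschitzWith K f}
  zero_mem' := ⟨0, LipschitzWith.const 0⟩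
  add_mem' := fun ⟨K, hK⟩ ⟨K', hK'⟩ => ⟨K + K', hK.add hK'⟩
  smul_mem' := fun c _ ⟨K, hK⟩ => ⟨‖c‖₊ * K, (lipschitzWith_smul c).comp hK⟩

/-- The order unit of `LipAlg G` is the constant function `1`. -/
instance LipAlg.instOne : One (LipAlg G) := ⟨⟨1, 0, LipschitzWith.const 1⟩⟩

/-- The lowest Lipschitz constant of a Lipschitz function. -/
def lipNorm (f : LipAlg G) : ℝ≥0∞ :=
  ⨅ (K : ℝ≥0) (_ : LipschitzWith K (f : C(G, ℝ))), (K : ℝ≥0∞)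

variable [CompactSpace G] [MeasurableSpace G] [BorelSpace G]

variable (G) in
/-- The normalized Haar measure. -/
abbrev haarProb : Measure G := Measure.haarMeasure (⊤ : TopologicalSpace.PositiveCompacts G)

instance haarProb_isProbabilityMeasure : IsProbabilityMeasure (haarProb G) :=
  ⟨Measure.haarMeasure_self⟩

instance haarProb_isMulRightInvariant : (haarProb G).IsMulRightInvariant where
  map_mul_right_eq_self g := by
    have : IsProbabilityMeasure ((haarProb G).map (· * g)) :=
      Measure.isProbabilityMeasure_map (by fun_prop)
    exact Measure.isHaarMeasure_eq_of_isProbabilityMeasure _ _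

variable (G) in
/-- The Hilbert space `L²(G)`. -/
abbrev L2 : Type u := Lp ℂ 2 (haarProb G)

/-- The left regular representation, `(U_g ψ)(x) = ψ(g⁻¹ x)`. -/
def leftReg (g : G) : L2 G →L[ℂ] L2 G :=
  (Lp.compMeasurePreservingₗᵢ ℂ (fun x : G => g⁻¹ * x)
    (measurePreserving_mul_left (haarProb G) g⁻¹)).toContinuousLinearMap

/-- The right regular representation, `(V_g ψ)(x) = ψ(x g)`. -/
def rightReg (g : G) : L2 G →L[ℂ] L2 G :=
  (Lp.compMeasurePreservingₗᵢ ℂ (fun x : G => x * g)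
    (measurePreserving_mul_right (haarProb G) g)).toContinuousLinearMap

/-- `λ_g(T) = U_g T U_g^*`. -/
def lamAct (g : G) (T : L2 G →L[ℂ] L2 G) : L2 G →L[ℂ] L2 G :=
  leftReg g ∘L T ∘L ContinuousLinearMap.adjoint (leftReg g)

/-- `ρ_g(T) = V_g T V_g^*`. -/
def rhoAct (g : G) (T : L2 G →L[ℂ] L2 G) : L2 G →L[ℂ] L2 G :=
  rightReg g ∘L T ∘L ContinuousLinearMap.adjoint (rightReg g)

/-- `‖T‖_λ`, possibly infinite. -/
def lamNorm (T : L2 G →L[ℂ] L2 G) : ℝ≥0∞ :=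
  ⨆ (x : G) (y : G) (_ : x ≠ y), ENNReal.ofReal (‖lamAct x T - lamAct y T‖ / dist x y)

/-- `‖T‖_ρ`, possibly infinite. -/
def rhoNorm (T : L2 G →L[ℂ] L2 G) : ℝ≥0∞ :=
  ⨆ (x : G) (y : G) (_ : x ≠ y), ENNReal.ofReal (‖rhoAct x T - rhoAct y T‖ / dist x y)

/-- The operator of pointwise multiplication by the real-valued continuous function `f`. -/
def mulOp : C(G, ℝ) →ₗ[ℝ] (L2 G →L[ℂ] L2 G) where
  toFun f := (ContinuousLinearMap.mul ℂ ℂ).holderL (haarProb G) ∞ 2 2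
    (ContinuousMap.toLp ∞ (haarProb G) ℂ ((⟨Complex.ofReal, Complex.continuous_ofReal⟩ :
      C(ℝ, ℂ)).comp f))
  map_add' f f' := by
    rw [← map_add, ← map_add]
    congr 2
    ext x
    simp
  map_smul' c f := by
    have h : (⟨Complex.ofReal, Complex.continuous_ofReal⟩ : C(ℝ, ℂ)).comp (c • f) =
        (c : ℂ) • (⟨Complex.ofReal, Complex.continuous_ofReal⟩ : C(ℝ, ℂ)).comp f := by
      ext x
      simp
    rw [h, map_smul, map_smul]
    ext1 ψ
    exact Complex.coe_smul c _

/-! ### Spectral truncations -/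

/-- The matrix coefficient `x ↦ ⟪ξ, π(x⁻¹) η⟫`. The linear span of these functions, for `π` fixed,
is the copy of `E_π ⊗ E_π^*` in `L²(G)`, where `U` acts on `η ∈ E_π` and `V` on
`⟪ξ, ·⟫ ∈ E_π^*`. -/
def matrixCoeff (π : UnitaryIrrep G) (ξ η : π.E) : C(G, ℂ) where
  toFun x := inner ℂ ξ ((π.rep x⁻¹ : π.E →L[ℂ] π.E) η)
  continuous_toFun := continuous_const.inner ((π.continuous_rep η).comp continuous_inv)

/-- `L²(G)_Λ`, the (closed) span of the `E_ν ⊗ E_ν^*` with `ν ∈ Λ`. -/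
def truncSpace (Λ : Finset (UnitaryDual G)) : Submodule ℂ (L2 G) :=
  (Submodule.span ℂ {ψ | ∃ (π : UnitaryIrrep G) (ξ η : π.E),
    (Quotient.mk _ π : UnitaryDual G) ∈ Λ ∧
      ψ = ContinuousMap.toLp 2 (haarProb G) ℂ (matrixCoeff π ξ η)}).topologicalClosure

instance (Λ : Finset (UnitaryDual G)) : CompleteSpace (truncSpace Λ) :=
  (Submodule.isClosed_topologicalClosure _).completeSpace_coe

/-- The orthogonal projection `P_Λ` of `L²(G)` onto `L²(G)_Λ`. -/
def truncProj (Λ : Finset (UnitaryDual G)) : L2 G →L[ℂ] L2 G := (truncSpace Λ).starProjection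

/-- The compression `T ↦ P_Λ T P_Λ`. -/
def compress (Λ : Finset (UnitaryDual G)) : (L2 G →L[ℂ] L2 G) →ₗ[ℝ] (L2 G →L[ℂ] L2 G) where
  toFun T := truncProj Λ ∘L T ∘L truncProj Λ
  map_add' S T := by ext; simp
  map_smul' c T := by
    ext1 ψ
    simp

/-- `A_Λ = P_Λ A P_Λ`, with the order inherited from the bounded operators on `L²(G)`. -/
def TruncAlg (Λ : Finset (UnitaryDual G)) : Submodule ℝ (L2 G →L[ℂ] L2 G) :=
  (LipAlg G).map (compress Λ ∘ₗ mulOp)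

/-- The map `τ_Λ : A → A_Λ`, `f ↦ P_Λ f P_Λ`. -/
def trunc (Λ : Finset (UnitaryDual G)) (f : LipAlg G) : TruncAlg Λ :=
  ⟨compress Λ (mulOp (f : C(G, ℝ))), Submodule.mem_map_of_mem f.2⟩

theorem mulOp_one : mulOp (1 : C(G, ℝ)) = ContinuousLinearMap.id ℂ (L2 G) := by
  ext1 ψ
  apply Lp.ext
  refine (ContinuousLinearMap.coeFn_holder _ _ _).trans ?_
  filter_upwards [ContinuousMap.coeFn_toLp (p := ∞) (𝕜 := ℂ) (haarProb G)
    ((⟨Complex.ofReal, Complex.continuous_ofReal⟩ : C(ℝ, ℂ)).comp (1 : C(G, ℝ)))] with x hx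
  rw [hx]
  simp

/-- The order unit of `A_Λ` is `P_Λ`, the identity of `L²(G)_Λ`. -/
instance TruncAlg.instOne (Λ : Finset (UnitaryDual G)) : One (TruncAlg Λ) :=
  ⟨⟨truncProj Λ, 1, (1 : LipAlg G).2, by
    change truncProj Λ ∘L mulOp (1 : C(G, ℝ)) ∘L truncProj Λ = truncProj Λ
    rw [mulOp_one, ContinuousLinearMap.id_comp]
    exact (truncSpace Λ).isIdempotentElem_starProjection⟩⟩

/-- `L_Λ`, the restriction of `‖·‖_{λ,ρ} = max (‖·‖_λ, ‖·‖_ρ)` to `A_Λ`. -/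
def truncLipNorm (Λ : Finset (UnitaryDual G)) (T : TruncAlg Λ) : ℝ≥0∞ :=
  max (lamNorm (T : L2 G →L[ℂ] L2 G)) (rhoNorm (T : L2 G →L[ℂ] L2 G))

/-! ### The action `ρ` on `A_Λ` -/

theorem coeFn_rightReg (g : G) (ψ : L2 G) :
    rightReg g ψ =ᵐ[haarProb G] fun x => ψ (x * g) :=
  Lp.coeFn_compMeasurePreserving ψ (measurePreserving_mul_right (haarProb G) g)

theorem rightReg_mul_inv (g : G) : rightReg g ∘L rightReg g⁻¹ = ContinuousLinearMap.id ℂ (L2 G) := by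
  ext1 ψ
  apply Lp.ext
  refine (coeFn_rightReg g (rightReg g⁻¹ ψ)).trans ?_
  filter_upwards [(measurePreserving_mul_right (haarProb G) g).quasiMeasurePreserving.ae
    (coeFn_rightReg g⁻¹ ψ)] with x hx
  simpa using hx

theorem adjoint_rightReg (g : G) : ContinuousLinearMap.adjoint (rightReg g) = rightReg g⁻¹ := by
  have h : ContinuousLinearMap.adjoint (rightReg g) ∘L rightReg g =
      ContinuousLinearMap.id ℂ (L2 G) :=
    (ContinuousLinearMap.norm_map_iff_adjoint_comp_self _).1 fun ψ =>
      (Lp.compMeasurePreservingₗᵢ ℂ (fun x : G => x * g)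
        (measurePreserving_mul_right (haarProb G) g)).norm_map ψ
  calc ContinuousLinearMap.adjoint (rightReg g)
      = ContinuousLinearMap.adjoint (rightReg g) ∘L (rightReg g ∘L rightReg g⁻¹) := by
        rw [rightReg_mul_inv, ContinuousLinearMap.comp_id]
    _ = rightReg g⁻¹ := by
        rw [← ContinuousLinearMap.comp_assoc, h, ContinuousLinearMap.id_comp]

theorem rightReg_mem_truncSpace (Λ : Finset (UnitaryDual G)) (g : G) {ψ : L2 G}
    (hψ : ψ ∈ truncSpace Λ) : rightReg g ψ ∈ truncSpace Λ := by
  refine map_mem_closure (rightReg g).continuous hψ fun φ hφ => ?_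
  refine (Submodule.span_le (p := (Submodule.span ℂ _).comap (rightReg g).toLinearMap)).2 ?_ hφ
  rintro _ ⟨π, ξ, η, hπ, rfl⟩
  refine Submodule.subset_span ⟨π, (π.rep g : π.E →L[ℂ] π.E) ξ, η, hπ, ?_⟩
  apply Lp.ext
  refine (coeFn_rightReg g _).trans ?_
  filter_upwards [(measurePreserving_mul_right (haarProb G) g).quasiMeasurePreserving.ae
    (ContinuousMap.coeFn_toLp (p := 2) (𝕜 := ℂ) (haarProb G) (matrixCoeff π ξ η)),
    ContinuousMap.coeFn_toLp (p := 2) (𝕜 := ℂ) (haarProb G)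
      (matrixCoeff π ((π.rep g : π.E →L[ℂ] π.E) ξ) η)] with x hx hx'
  rw [hx, hx']
  have hu : ContinuousLinearMap.adjoint (π.rep g : π.E →L[ℂ] π.E) = (π.rep g⁻¹ : π.E →L[ℂ] π.E) := by
    rw [map_inv]
    rfl
  simp only [matrixCoeff, ContinuousMap.coe_mk]
  rw [← ContinuousLinearMap.adjoint_inner_right, hu, mul_inv_rev, map_mul]
  rfl

theorem rightReg_comp_truncProj (Λ : Finset (UnitaryDual G)) (g : G) :
    rightReg g ∘L truncProj Λ = truncProj Λ ∘L rightReg g := by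
  ext1 ψ
  refine (Submodule.eq_starProjection_of_mem_of_inner_eq_zero ?_ fun w hw => ?_).symm
  · exact rightReg_mem_truncSpace Λ g (Submodule.starProjection_apply_mem _ ψ)
  · change inner ℂ (rightReg g ψ - rightReg g (truncProj Λ ψ)) w = 0
    rw [← map_sub, ← ContinuousLinearMap.adjoint_inner_right, adjoint_rightReg]
    exact Submodule.starProjection_inner_eq_zero ψ _ (rightReg_mem_truncSpace Λ g⁻¹ hw)

theorem rightReg_comp_mulOp (g : G) (f : C(G, ℝ)) :
    rightReg g ∘L mulOp f = mulOp (f.comp ⟨fun x => x * g, by fun_prop⟩) ∘L rightReg g := by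
  ext1 ψ
  apply Lp.ext
  refine (coeFn_rightReg g _).trans ?_
  refine Filter.EventuallyEq.trans ?_ (ContinuousLinearMap.coeFn_holder _ _ _).symm
  have hq := (measurePreserving_mul_right (haarProb G) g).quasiMeasurePreserving
  filter_upwards [hq.ae (ContinuousLinearMap.coeFn_holder (r := 2) (ContinuousLinearMap.mul ℂ ℂ)
      (ContinuousMap.toLp ∞ (haarProb G) ℂ
        ((⟨Complex.ofReal, Complex.continuous_ofReal⟩ : C(ℝ, ℂ)).comp f)) ψ),
    hq.ae (ContinuousMap.coeFn_toLp (p := ∞) (𝕜 := ℂ) (haarProb G)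
      ((⟨Complex.ofReal, Complex.continuous_ofReal⟩ : C(ℝ, ℂ)).comp f)),
    ContinuousMap.coeFn_toLp (p := ∞) (𝕜 := ℂ) (haarProb G)
      ((⟨Complex.ofReal, Complex.continuous_ofReal⟩ : C(ℝ, ℂ)).comp
        (f.comp ⟨fun x => x * g, by fun_prop⟩)),
    coeFn_rightReg g ψ] with x h1 h2 h3 h4
  rw [h3]
  refine h1.trans ?_
  rw [h2]
  exact congrArg _ h4.symm

theorem rhoAct_mem_truncAlg (Λ : Finset (UnitaryDual G)) (g : G) {T : L2 G →L[ℂ] L2 G}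
    (hT : T ∈ TruncAlg Λ) : rhoAct g T ∈ TruncAlg Λ := by
  obtain ⟨f, ⟨K, hK⟩, rfl⟩ := hT
  refine ⟨f.comp ⟨fun x => x * g, by fun_prop⟩, ⟨K * 1, hK.comp ?_⟩, ?_⟩
  · exact (Isometry.of_dist_eq fun x y : G => dist_mul_right x y g).lipschitz
  · change truncProj Λ ∘L mulOp _ ∘L truncProj Λ =
      rightReg g ∘L (truncProj Λ ∘L mulOp f ∘L truncProj Λ) ∘L
        ContinuousLinearMap.adjoint (rightReg g)
    rw [adjoint_rightReg]
    have h1 := rightReg_comp_truncProj Λ g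
    have h2 := rightReg_comp_mulOp g f
    have h3 := rightReg_mul_inv g
    ext1 ψ
    simp only [DFunLike.ext_iff, ContinuousLinearMap.comp_apply] at h1 h2 h3 ⊢
    rw [h1, h2, h1, h3]
    rfl

/-- The restriction of `ρ_g` to `A_Λ`. -/
def truncRho (Λ : Finset (UnitaryDual G)) (g : G) (T : TruncAlg Λ) : TruncAlg Λ :=
  ⟨rhoAct g T, rhoAct_mem_truncAlg Λ g T.2⟩

/-- The state `σ` on `A_Λ` is the lift of the measure `μ`: `σ ∘ τ_Λ = μ` on the Lipschitz
functions. There is at most one such state, since `τ_Λ : A → A_Λ` is onto. -/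
def IsLift (Λ : Finset (UnitaryDual G)) (μ : Measure G) (σ : State (TruncAlg Λ)) : Prop :=
  ∀ f : LipAlg G, σ (trunc Λ f) = ∫ x, (f : C(G, ℝ)) x ∂μ

end MetricGroup

end

/-! Two morphisms run in opposite directions: the compression `truncHom`, f ↦ P f P, and the symbol
map `covariantSymbol`, written υ below, T ↦ (g ↦ μΛ(ρ_g T)). Neither increases the Lip-norm.
Conjugating P f P by U or V amounts to translating f, and compression does not increase the norm, so
a Lipschitz constant of f bounds ‖P f P‖ in both seminorms. Conversely, states are contractive for
the operator norm, so ‖T‖_ρ bounds the Lipschitz constant of the symbol of T.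

The two maps are almost inverse to each other. Since μΛ lifts μ, the symbol of P f P is g ↦ ∫ f(xg)
dμ(x), an average of left translates of f (`IsLift.covariantSymbol_trunc`). By invariance of d it
differs from f by at most the Lipschitz constant of f times ∫ d(e,x) dμ(x). Compressing the same
average gives an average of the λ_{x⁻¹}(T), T = P f P, so compression after υ moves T by at most
‖T‖_λ ∫ d(e,x) dμ(x); no bound on the Lipschitz constant of f enters. Thus the ρ part of L_Λ
controls υ, and the λ part controls the error. Dualizing yields contractions between the state
spaces that are inverse up to this error, and comparing their graphs bounds the Gromov–Hausdorff
distance without losing a factor (`ghDist_le_of_contractions`).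

That both pairs are quantum metric spaces follows from Rieffel's criterion
(`IsLipNorm.of_totallyBounded`). For Lipschitz functions total boundedness is an Arzelà–Ascoli
argument. For A_Λ it combines finite dimensionality, which rests on
`UnitaryIrrep.finiteDimensional`, with boundedness of the unit ball modulo scalars, obtained by
averaging over right translations (`norm_compressMul_sub_mean_le`). -/

noncomputable section

/-! ### States, Lip-norms and Rieffel's criterion. -/

section AbstractStates

variable {A B : Type*} [AddCommGroup A] [PartialOrder A] [Module ℝ A] [One A]
  [AddCommGroup B] [PartialOrder B] [Module ℝ B] [One B]

namespace OrderUnitHom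

theorem map_one (φ : OrderUnitHom A B) : φ 1 = 1 := φ.map_one'

theorem map_add (φ : OrderUnitHom A B) (a b : A) : φ (a + b) = φ a + φ b := φ.map_add' a b

theorem map_smul (φ : OrderUnitHom A B) (r : ℝ) (a : A) : φ (r • a) = r • φ a := φ.map_smul' r a

theorem map_neg (φ : OrderUnitHom A B) (a : A) : φ (-a) = -φ a := by
  simpa using φ.map_smul (-1) a

theorem map_sub (φ : OrderUnitHom A B) (a b : A) : φ (a - b) = φ a - φ b := by
  rw [sub_eq_add_neg, map_add, map_neg, sub_eq_add_neg]

theorem mono (φ : OrderUnitHom A B) {a b : A} (h : a ≤ b) : φ a ≤ φ b := φ.monotone' h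

end OrderUnitHom

/-- The order interval `-r • 1 ≤ a ≤ r • 1`. -/
def OrderBounded (a : A) (r : ℝ) : Prop := a ≤ r • (1 : A) ∧ -a ≤ r • (1 : A)

theorem State.abs_le (σ : State A) {a : A} {r : ℝ} (h : OrderBounded a r) : |σ a| ≤ r := by
  have h1 := σ.mono h.1
  have h2 := σ.mono h.2
  rw [σ.map_smul, σ.map_one, smul_eq_mul, mul_one] at h1 h2
  rw [σ.map_neg] at h2
  exact _root_.abs_le.2 ⟨by linarith, h1⟩

/-- The state `σ ∘ φ`. -/
def State.pullback (φ : OrderUnitHom A B) (σ : State B) : State A where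
  toFun a := σ (φ a)
  map_add' a b := by rw [φ.map_add, σ.map_add]
  map_smul' r a := by rw [φ.map_smul, σ.map_smul]; rfl
  monotone' _ _ h := σ.mono (φ.mono h)
  map_one' := by
    rw [φ.map_one, σ.map_one]

theorem lipEDist_self (L : A → ℝ≥0∞) (σ : State A) : lipEDist L σ σ = 0 := by
  simp [lipEDist]

theorem lipEDist_comm (L : A → ℝ≥0∞) (σ τ : State A) : lipEDist L σ τ = lipEDist L τ σ := by
  simp only [lipEDist, abs_sub_comm]

theorem lipEDist_triangle (L : A → ℝ≥0∞) (σ τ υ : State A) :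
    lipEDist L σ υ ≤ lipEDist L σ τ + lipEDist L τ υ := by
  refine iSup₂_le fun a ha => ?_
  calc ENNReal.ofReal |σ a - υ a|
      ≤ ENNReal.ofReal (|σ a - τ a| + |τ a - υ a|) :=
        ENNReal.ofReal_le_ofReal (abs_sub_le _ _ _)
    _ = ENNReal.ofReal |σ a - τ a| + ENNReal.ofReal |τ a - υ a| :=
        ENNReal.ofReal_add (abs_nonneg _) (abs_nonneg _)
    _ ≤ _ := add_le_add (le_iSup₂_of_le a ha le_rfl) (le_iSup₂_of_le a ha le_rfl)

theorem lipEDist_pullback_le {LA : A → ℝ≥0∞} {LB : B → ℝ≥0∞} {φ : OrderUnitHom A B}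
    (hφ : φ.IsLipMorphism LA LB) (σ τ : State B) :
    lipEDist LA (State.pullback φ σ) (State.pullback φ τ) ≤ lipEDist LB σ τ :=
  iSup₂_le fun a ha => le_iSup₂_of_le (f := fun b (_ : LB b ≤ 1) => ENNReal.ofReal |σ b - τ b|)
    (φ a) ((hφ a).trans ha) le_rfl

/-- Rescale a to the unit sphere of L; if L a = 0, then a is a scalar and all states agree on it. -/
theorem ofReal_abs_sub_le_mul_lipEDist {L : A → ℝ≥0∞} (ne_top : ∀ a, L a ≠ ∞)
    (smul_eq : ∀ (r : ℝ) (a : A), L (r • a) = ENNReal.ofReal |r| * L a)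
    (eq_zero : ∀ a, L a = 0 → ∃ r : ℝ, a = r • (1 : A)) (σ τ : State A) (a : A) :
    ENNReal.ofReal |σ a - τ a| ≤ L a * lipEDist L σ τ := by
  by_cases h0 : L a = 0
  · obtain ⟨r, rfl⟩ := eq_zero a h0
    simp [OrderUnitHom.map_smul, OrderUnitHom.map_one]
  · have hc : 0 < (L a).toReal := ENNReal.toReal_pos h0 (ne_top a)
    have h1 : L ((L a).toReal⁻¹ • a) ≤ 1 := by
      rw [smul_eq, abs_of_pos (inv_pos.2 hc), ENNReal.ofReal_inv_of_pos hc,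
        ENNReal.ofReal_toReal (ne_top a), ENNReal.inv_mul_cancel h0 (ne_top a)]
    have h2 : ENNReal.ofReal |σ ((L a).toReal⁻¹ • a) - τ ((L a).toReal⁻¹ • a)| ≤
        lipEDist L σ τ :=
      le_iSup₂_of_le (f := fun b (_ : L b ≤ 1) => ENNReal.ofReal |σ b - τ b|) _ h1 le_rfl
    rw [σ.map_smul, τ.map_smul, ← smul_sub, smul_eq_mul, abs_mul, abs_of_pos (inv_pos.2 hc),
      ENNReal.ofReal_mul (inv_pos.2 hc).le, ENNReal.ofReal_inv_of_pos hc,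
      ENNReal.ofReal_toReal (ne_top a)] at h2
    calc ENNReal.ofReal |σ a - τ a| = L a * ((L a)⁻¹ * ENNReal.ofReal |σ a - τ a|) := by
          rw [← mul_assoc, ENNReal.mul_inv_cancel h0 (ne_top a), one_mul]
      _ ≤ _ := by gcongr

/-- The unit ball of `L` is totally bounded modulo the multiples of the order unit. -/
def LipBallTotallyBounded (L : A → ℝ≥0∞) : Prop :=
  ∀ ε : ℝ, 0 < ε → ∃ F : Set A, F.Finite ∧
    ∀ a, L a ≤ 1 → ∃ b ∈ F, ∃ r : ℝ, OrderBounded (a - b - r • (1 : A)) ε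

/-- Any two states agree on r • 1, so replacing a by a net element costs ε once for each state. -/
theorem lipEDist_le_of_net {L : A → ℝ≥0∞} {F : Set A} {ε δ : ℝ}
    (hF : ∀ a, L a ≤ 1 → ∃ b ∈ F, ∃ r : ℝ, OrderBounded (a - b - r • (1 : A)) ε)
    {σ τ : State A} (h : ∀ b ∈ F, |σ b - τ b| ≤ δ) :
    lipEDist L σ τ ≤ ENNReal.ofReal (δ + 2 * ε) := by
  refine iSup₂_le fun a ha => ENNReal.ofReal_le_ofReal ?_
  obtain ⟨b, hb, r, hr⟩ := hF a ha
  have h1 := State.abs_le σ hr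
  have h2 := State.abs_le τ hr
  have h3 := h b hb
  simp only [OrderUnitHom.map_sub, OrderUnitHom.map_smul, OrderUnitHom.map_one] at h1 h2
  rw [abs_le] at *
  constructor <;> linarith [h1.1, h1.2, h2.1, h2.2, h3.1, h3.2]

/-- Rieffel's criterion: a seminorm whose kernel is `ℝ1` is a Lip-norm if its unit ball is totally
bounded modulo `ℝ1`. -/
theorem IsLipNorm.of_totallyBounded {L : A → ℝ≥0∞} (ne_top : ∀ a, L a ≠ ∞)
    (add_le : ∀ a b, L (a + b) ≤ L a + L b)
    (smul_eq : ∀ (r : ℝ) (a : A), L (r • a) = ENNReal.ofReal |r| * L a)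
    (eq_zero_iff : ∀ a, L a = 0 ↔ ∃ r : ℝ, a = r • (1 : A))
    (htb : LipBallTotallyBounded L) : IsLipNorm L := by
  refine ⟨ne_top, add_le, smul_eq, eq_zero_iff, ?_⟩
  have hlip := ofReal_abs_sub_le_mul_lipEDist ne_top smul_eq fun a => (eq_zero_iff a).1
  have hfin : ∀ σ τ : State A, lipEDist L σ τ ≠ ∞ := fun σ τ => by
    obtain ⟨F, hFfin, hF⟩ := htb 1 one_pos
    obtain ⟨δ, hδ⟩ := (hFfin.image fun b => |σ b - τ b|).bddAbove
    exact ne_top_of_le_ne_top ENNReal.ofReal_ne_top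
      (lipEDist_le_of_net hF fun b hb => hδ (Set.mem_image_of_mem _ hb))
  let e : EMetricSpace (State A) :=
    { edist := lipEDist L
      edist_self := lipEDist_self L
      edist_comm := lipEDist_comm L
      edist_triangle := lipEDist_triangle L
      eq_of_edist_eq_zero := fun {σ τ} h => by
        refine DFunLike.ext _ _ fun a => ?_
        have h1 := hlip σ τ a
        change lipEDist L σ τ = 0 at h
        rw [h, mul_zero, nonpos_iff_eq_zero, ENNReal.ofReal_eq_zero] at h1
        exact sub_eq_zero.1 (abs_eq_zero.1 (le_antisymm h1 (abs_nonneg _))) }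
  -- Evaluation at a is Lipschitz with constant L a for d_L, so d_L induces a topology at least as
  -- fine as the weak-* one.
  have hcont' : ∀ a : A,
      @Continuous _ _ e.toUniformSpace.toTopologicalSpace _ fun τ : State A => τ a := fun a =>
    @LipschitzWith.continuous _ _ e.toPseudoEMetricSpace _ (L a).toNNReal _ fun σ τ => by
      rw [ENNReal.coe_toNNReal (ne_top a), edist_dist, Real.dist_eq]
      exact hlip σ τ a
  refine ⟨EMetricSpace.toMetricSpace hfin, fun _ _ => rfl, le_antisymm ?_ ?_⟩
  · exact continuous_iff_le_induced.1 (@continuous_pi _ _ _ e.toUniformSpace.toTopologicalSpace _ _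
      hcont')
  -- Conversely, closeness on a finite net is a weak-* open condition up to shrinking, and it forces
  -- closeness in d_L.
  · refine le_of_nhds_le_nhds fun σ => ?_
    refine (Metric.nhds_basis_eball (x := σ)).ge_iff.2 fun ε hε => ?_
    obtain ⟨η, hη0, hη⟩ : ∃ η : ℝ, 0 < η ∧ ENNReal.ofReal (η + 2 * η) < ε := by
      obtain ⟨q, hq0, hq⟩ := ENNReal.lt_iff_exists_real_btwn.1 hε
      refine ⟨q / 3, ?_, ?_⟩
      · have := ENNReal.ofReal_pos.1 hq.1
        positivity
      · convert hq.2 using 2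
        ring
    obtain ⟨F, hFfin, hF⟩ := htb η hη0
    have hcont : ∀ b : A, @Continuous _ _ State.instTopologicalSpace _ fun τ : State A => τ b :=
      fun b => (continuous_apply b).comp continuous_induced_dom
    have : {τ : State A | ∀ b ∈ F, |τ b - σ b| ≤ η} ∈
        @nhds _ State.instTopologicalSpace σ := by
      refine (Filter.eventually_all_finite hFfin).2 fun b _ => ?_
      have h := (hcont b).continuousAt (x := σ) (Metric.closedBall_mem_nhds (σ b) hη0)
      filter_upwards [h] with τ hτ using hτ
    filter_upwards [this] with τ hτ
    exact (lipEDist_le_of_net hF hτ).trans_lt hη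

theorem StateSpace.edist_eq {L : A → ℝ≥0∞} (h : IsQuantumMetricSpace L) (σ τ : StateSpace h) :
    edist σ τ = lipEDist L σ τ :=
  h.isLipNorm.metrizes.choose_spec.1 σ τ

theorem StateSpace.dist_le_of_forall {L : A → ℝ≥0∞} (h : IsQuantumMetricSpace L) {r : ℝ}
    (hr : 0 ≤ r) {σ τ : State A} (hστ : ∀ a, L a ≤ 1 → |σ a - τ a| ≤ r) :
    dist (α := StateSpace h) σ τ ≤ r :=
  (edist_le_ofReal hr).1 <| (StateSpace.edist_eq h σ τ).le.trans <|
    iSup₂_le fun a ha => ENNReal.ofReal_le_ofReal (hστ a ha)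

/-- The map of state spaces induced by an order-unit morphism. -/
def StateSpace.pullback {LA : A → ℝ≥0∞} {LB : B → ℝ≥0∞} (hA : IsQuantumMetricSpace LA)
    (hB : IsQuantumMetricSpace LB) (φ : OrderUnitHom A B) : StateSpace hB → StateSpace hA :=
  State.pullback φ

theorem StateSpace.lipschitzWith_pullback {LA : A → ℝ≥0∞} {LB : B → ℝ≥0∞}
    (hA : IsQuantumMetricSpace LA) (hB : IsQuantumMetricSpace LB) {φ : OrderUnitHom A B}
    (hφ : φ.IsLipMorphism LA LB) : LipschitzWith 1 (StateSpace.pullback hA hB φ) := fun σ τ => by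
  rw [StateSpace.edist_eq, StateSpace.edist_eq, ENNReal.coe_one, one_mul]
  exact lipEDist_pullback_le hφ σ τ

end AbstractStates

/-! ### From approximate inverses to Gromov–Hausdorff bounds. -/

/-- Compact metric spaces with mutually approximately inverse contractions are close in the
Gromov–Hausdorff distance. -/
theorem ghDist_le_of_contractions {X Y : Type*} [MetricSpace X] [CompactSpace X] [Nonempty X]
    [MetricSpace Y] [CompactSpace Y] [Nonempty Y] {f : X → Y} {g : Y → X} {r : ℝ} (hr : 0 ≤ r)
    (hf : LipschitzWith 1 f) (hg : LipschitzWith 1 g) (hgf : ∀ x, dist (g (f x)) x ≤ r)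
    (hfg : ∀ y, dist (f (g y)) y ≤ r) : GromovHausdorff.ghDist X Y ≤ r := by
  -- Embed both spaces in X × Y as graphs. The product carries the max metric, so the graph of a
  -- contraction is an isometric copy of its domain.
  have hΦ : Isometry fun x => (x, f x) := Isometry.of_dist_eq fun x x' => by
    simpa [Prod.dist_eq] using hf.dist_le_mul x x'
  have hΨ : Isometry fun y => (g y, y) := Isometry.of_dist_eq fun y y' => by
    simpa [Prod.dist_eq] using hg.dist_le_mul y y'
  refine (GromovHausdorff.ghDist_le_hausdorffDist hΦ hΨ).trans
    (Metric.hausdorffDist_le_of_mem_dist hr ?_ ?_)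
  · rintro _ ⟨x, rfl⟩
    exact ⟨_, ⟨f x, rfl⟩, by simpa [Prod.dist_eq, hr, dist_comm x] using hgf x⟩
  · rintro _ ⟨y, rfl⟩
    exact ⟨_, ⟨g y, rfl⟩, by simpa [Prod.dist_eq, hr, dist_comm y] using hfg y⟩

/-- Quantum metric spaces with mutually approximately inverse Lip-morphisms have state spaces that
are close in the Gromov–Hausdorff distance. -/
theorem ghDist_stateSpace_le {A B : Type*} [AddCommGroup A] [PartialOrder A] [Module ℝ A] [One A]
    [AddCommGroup B] [PartialOrder B] [Module ℝ B] [One B] {LA : A → ℝ≥0∞} {LB : B → ℝ≥0∞}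
    (hA : IsQuantumMetricSpace LA) (hB : IsQuantumMetricSpace LB)
    [Nonempty (State A)] [Nonempty (State B)] {φ : OrderUnitHom A B} {ψ : OrderUnitHom B A}
    (hφ : φ.IsLipMorphism LA LB) (hψ : ψ.IsLipMorphism LB LA) {r : ℝ} (hr : 0 ≤ r)
    (hψφ : ∀ a, LA a ≤ 1 → OrderBounded (ψ (φ a) - a) r)
    (hφψ : ∀ b, LB b ≤ 1 → OrderBounded (φ (ψ b) - b) r) :
    GromovHausdorff.ghDist (StateSpace hA) (StateSpace hB) ≤ r := by
  -- Pulling back is contravariant: the state σ ∘ ψ ∘ φ is compared with σ by evaluating σ on ψ (φ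
  -- a) - a.
  refine ghDist_le_of_contractions (f := StateSpace.pullback hB hA ψ)
    (g := StateSpace.pullback hA hB φ) hr (StateSpace.lipschitzWith_pullback hB hA hψ)
    (StateSpace.lipschitzWith_pullback hA hB hφ) (fun σ => ?_) (fun σ => ?_)
  · refine StateSpace.dist_le_of_forall hA hr fun a ha => ?_
    exact (congrArg abs (OrderUnitHom.map_sub (A := A) (B := ℝ) σ _ _)).ge.trans
      (State.abs_le (A := A) σ (hψφ a ha))
  · refine StateSpace.dist_le_of_forall hB hr fun b hb => ?_
    exact (congrArg abs (OrderUnitHom.map_sub (A := B) (B := ℝ) σ _ _)).ge.trans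
      (State.abs_le (A := B) σ (hφψ b hb))

/-! ### Finite dimensionality of irreducible representations and of the truncated Hilbert space. -/

section FiniteDimensionality

namespace UnitaryIrrep

section Algebra

variable {G : Type u} [Group G] [TopologicalSpace G]

theorem rep_mul_apply (π : UnitaryIrrep G) (g h : G) (v : π.E) :
    (π.rep (g * h) : π.E →L[ℂ] π.E) v = (π.rep g : π.E →L[ℂ] π.E) ((π.rep h : π.E →L[ℂ] π.E) v) := by
  rw [map_mul]
  rfl

theorem inner_rep_inv_left (π : UnitaryIrrep G) (g : G) (v w : π.E) :
    inner ℂ ((π.rep g⁻¹ : π.E →L[ℂ] π.E) v) w = inner ℂ v ((π.rep g : π.E →L[ℂ] π.E) w) := by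
  have hu : ContinuousLinearMap.adjoint (π.rep g : π.E →L[ℂ] π.E) =
      (π.rep g⁻¹ : π.E →L[ℂ] π.E) := by
    rw [map_inv]
    rfl
  rw [← hu, ContinuousLinearMap.adjoint_inner_left]

/-- The projection onto the line spanned by `π(g) v`, up to a factor. -/
def orbitRankOne (π : UnitaryIrrep G) (v : π.E) (g : G) : π.E →L[ℂ] π.E :=
  InnerProductSpace.rankOne ℂ ((π.rep g : π.E →L[ℂ] π.E) v) ((π.rep g : π.E →L[ℂ] π.E) v)

/-- Strong continuity of π suffices for norm continuity here, because a rank one operator depends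
norm-continuously on its vectors. Hence the orbit average exists as a Bochner integral in operator
norm. -/
theorem continuous_orbitRankOne (π : UnitaryIrrep G) (v : π.E) :
    Continuous (π.orbitRankOne v) := by
  have h := π.continuous_rep v
  exact ((ContinuousLinearMap.smulRightL ℂ π.E π.E).continuous.comp
    ((innerSL ℂ).continuous.comp h)).clm_apply h

theorem isCompactOperator_orbitRankOne (π : UnitaryIrrep G) (v : π.E) (g : G) :
    IsCompactOperator (π.orbitRankOne v g) := by
  rw [orbitRankOne, InnerProductSpace.rankOne_def']
  exact (isCompactOperator_of_locallyCompactSpace_rng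
    (ContinuousLinearMap.toSpanSingleton ℂ _)).comp_clm _

end Algebra

variable {G : Type u} [Group G] [MetricSpace G] [IsIsometricSMul G G] [IsIsometricSMul Gᵐᵒᵖ G]
  [CompactSpace G] [MeasurableSpace G] [BorelSpace G]

/-- The average of the rank one operators along an orbit. -/
def orbitAverage (π : UnitaryIrrep G) (v : π.E) : π.E →L[ℂ] π.E :=
  ∫ g, π.orbitRankOne v g ∂haarProb G

theorem integrable_orbitRankOne (π : UnitaryIrrep G) (v : π.E) :
    Integrable (π.orbitRankOne v) (haarProb G) :=
  (π.continuous_orbitRankOne v).integrable_of_hasCompactSupport (HasCompactSupport.of_compactSpace _)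

theorem orbitAverage_apply (π : UnitaryIrrep G) (v w : π.E) :
    π.orbitAverage v w = ∫ g, inner ℂ ((π.rep g : π.E →L[ℂ] π.E) v) w •
      (π.rep g : π.E →L[ℂ] π.E) v ∂haarProb G :=
  ContinuousLinearMap.integral_apply (π.integrable_orbitRankOne v) w

/-- Compact operators form a norm-closed convex set, which contains the mean of any integrable
family in it. -/
theorem isCompactOperator_orbitAverage (π : UnitaryIrrep G) (v : π.E) :
    IsCompactOperator (π.orbitAverage v) := by
  have hc : Convex ℝ {T : π.E →L[ℂ] π.E | IsCompactOperator T} := by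
    intro S hS T hT a b _ _ _
    exact (hS.smul a).add (hT.smul b)
  exact hc.integral_mem isClosed_setOfPred_isCompactOperator
    (Filter.Eventually.of_forall (π.isCompactOperator_orbitRankOne v))
    (π.integrable_orbitRankOne v)

theorem isSymmetric_orbitAverage (π : UnitaryIrrep G) (v : π.E) :
    (π.orbitAverage v).IsSymmetric := by
  have hc : Convex ℝ {T : π.E →L[ℂ] π.E | IsSelfAdjoint T} := by
    intro S hS T hT a b _ _ _
    exact ((IsSelfAdjoint.all a).smul hS).add ((IsSelfAdjoint.all b).smul hT)
  have hcl : IsClosed {T : π.E →L[ℂ] π.E | IsSelfAdjoint T} :=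
    isClosed_eq continuous_star continuous_id
  refine ContinuousLinearMap.isSelfAdjoint_iff_isSymmetric.1 (hc.integral_mem hcl
    (Filter.Eventually.of_forall fun g => ?_) (π.integrable_orbitRankOne v))
  exact ContinuousLinearMap.isSelfAdjoint_iff_isSymmetric.2
    (InnerProductSpace.isSymmetric_rankOne_self _)

/-- Left invariance of Haar measure: substituting hg for g moves π(h) across the inner product, so
the average intertwines π with itself. -/
theorem rep_orbitAverage (π : UnitaryIrrep G) (v : π.E) (h : G) (w : π.E) :
    (π.rep h : π.E →L[ℂ] π.E) (π.orbitAverage v w) =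
      π.orbitAverage v ((π.rep h : π.E →L[ℂ] π.E) w) := by
  have hi := (π.integrable_orbitRankOne v).apply_continuousLinearMap w
  rw [orbitAverage_apply, orbitAverage_apply,
    ← integral_mul_left_eq_self (μ := haarProb G)
      (fun g => inner ℂ ((π.rep g : π.E →L[ℂ] π.E) v) ((π.rep h : π.E →L[ℂ] π.E) w) •
        (π.rep g : π.E →L[ℂ] π.E) v) h]
  refine (ContinuousLinearMap.integral_comp_comm _ hi).symm.trans (integral_congr_ae ?_)
  filter_upwards with g
  simp only [orbitRankOne, InnerProductSpace.rankOne_apply, map_smul, rep_mul_apply]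
  rw [← inner_rep_inv_left, ← rep_mul_apply, ← rep_mul_apply, inv_mul_cancel_left]

/-- The diagonal coefficient at v is ∫ |⟪v, π(g) v⟫|² dg, whose continuous nonnegative integrand is
positive at g = 1. -/
theorem orbitAverage_ne_zero (π : UnitaryIrrep G) {v : π.E} (hv : v ≠ 0) :
    π.orbitAverage v ≠ 0 := by
  intro h0
  have h1 : inner ℂ v (π.orbitAverage v v) = 0 := by rw [h0]; simp
  have hi := (π.integrable_orbitRankOne v).apply_continuousLinearMap v
  rw [orbitAverage, ContinuousLinearMap.integral_apply (π.integrable_orbitRankOne v),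
    ← innerSL_apply_apply ℂ, ← ContinuousLinearMap.integral_comp_comm _ hi] at h1
  have h2 : ∀ g : G, innerSL ℂ v (π.orbitRankOne v g v) =
      ((‖inner ℂ v ((π.rep g : π.E →L[ℂ] π.E) v)‖ ^ 2 : ℝ) : ℂ) := fun g => by
    rw [innerSL_apply_apply, orbitRankOne, InnerProductSpace.rankOne_apply, inner_smul_right,
      ← inner_conj_symm, ← Complex.normSq_eq_conj_mul_self, Complex.normSq_eq_norm_sq]
  simp_rw [h2] at h1
  rw [integral_complex_ofReal, Complex.ofReal_eq_zero] at h1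
  have hcont : Continuous fun g : G => ‖inner ℂ v ((π.rep g : π.E →L[ℂ] π.E) v)‖ ^ 2 :=
    ((continuous_const.inner (π.continuous_rep v)).norm).pow 2
  have hpos := hcont.integral_pos_of_hasCompactSupport_nonneg_nonzero (μ := haarProb G)
    (HasCompactSupport.of_compactSpace _) (fun g => sq_nonneg _) (x := 1) (by simpa using hv)
  exact hpos.ne' h1

/-- Irreducible unitary representations of a compact group are finite-dimensional. -/
theorem finiteDimensional (π : UnitaryIrrep G) : FiniteDimensional ℂ π.E := by
  have := π.nontrivial
  obtain ⟨v, hv⟩ := exists_ne (0 : π.E)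
  have hK := π.isCompactOperator_orbitAverage v
  -- A compact symmetric operator without nonzero eigenvalues vanishes.
  obtain ⟨c, hc, hc0⟩ : ∃ c, Module.End.HasEigenvalue (π.orbitAverage v : Module.End ℂ π.E) c ∧
      c ≠ 0 := by
    by_contra! h
    exact π.orbitAverage_ne_zero hv
      ((ContinuousLinearMap.eq_zero_of_forall_hasEigenvalue_eq_zero hK
        (π.isSymmetric_orbitAverage v)).1 h)
  have hfd := ContinuousLinearMap.finite_dimensional_eigenspace hK c hc0
  have hmem : ∀ w : π.E, w ∈ Module.End.eigenspace (π.orbitAverage v : Module.End ℂ π.E) c ↔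
      π.orbitAverage v w = c • w := fun w => Module.End.mem_eigenspace_iff
  -- The eigenspace for c is invariant, and closed because it is finite-dimensional; by
  -- irreducibility it is the whole space.
  rcases π.irreducible (Module.End.eigenspace (π.orbitAverage v : Module.End ℂ π.E) c)
    (Submodule.closed_of_finiteDimensional _) (fun g w hw => by
      rw [hmem] at hw ⊢
      rw [← rep_orbitAverage, hw, map_smul]) with h | h
  · exact absurd h hc
  · rw [h] at hfd
    exact Module.Finite.equiv Submodule.topEquiv

end UnitaryIrrep

variable {G : Type u} [Group G] [MetricSpace G] [IsIsometricSMul G G] [IsIsometricSMul Gᵐᵒᵖ G]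

/-- Allows one fixed representative per class, so that finitely many coefficients suffice for a
finite Λ. -/
theorem matrixCoeff_of_equiv {π π' : UnitaryIrrep G} (e : π.E ≃ₗᵢ[ℂ] π'.E)
    (he : ∀ (g : G) (v : π.E),
      e ((π.rep g : π.E →L[ℂ] π.E) v) = (π'.rep g : π'.E →L[ℂ] π'.E) (e v)) (ξ η : π.E) :
    matrixCoeff π ξ η = matrixCoeff π' (e ξ) (e η) := by
  ext x
  simp only [matrixCoeff, ContinuousMap.coe_mk]
  rw [← he, LinearIsometryEquiv.inner_map_map]

variable [CompactSpace G] [MeasurableSpace G] [BorelSpace G]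

theorem matrixCoeff_mem_span (π : UnitaryIrrep G) {ι : Type*} [Fintype ι]
    (b : Module.Basis ι ℂ π.E) (ξ η : π.E) :
    ContinuousMap.toLp 2 (haarProb G) ℂ (matrixCoeff π ξ η) ∈
      Submodule.span ℂ (Set.range fun p : ι × ι =>
        ContinuousMap.toLp 2 (haarProb G) ℂ (matrixCoeff π (b p.1) (b p.2))) := by
  have h : matrixCoeff π ξ η = ∑ i, ∑ j,
      ((starRingEnd ℂ) (b.repr ξ i) * b.repr η j) • matrixCoeff π (b i) (b j) := by
    ext x
    conv_lhs => rw [← b.sum_repr ξ, ← b.sum_repr η]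
    simp only [matrixCoeff, ContinuousMap.coe_mk, map_sum, map_smul, sum_inner, inner_sum,
      inner_smul_left, inner_smul_right, ContinuousMap.coe_sum, ContinuousMap.coe_smul,
      Finset.sum_apply, Pi.smul_apply, smul_eq_mul, mul_assoc, Finset.mul_sum]
    rw [Finset.sum_comm]
    simp only [mul_left_comm]
  rw [h]
  simp only [map_sum, map_smul]
  exact Submodule.sum_mem _ fun i _ => Submodule.sum_mem _ fun j _ =>
    Submodule.smul_mem _ _ (Submodule.subset_span ⟨(i, j), rfl⟩)

/-- The coefficients of chosen representatives in chosen bases form a finite set. Its span is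
finite-dimensional, hence closed, so passing to the closure adds nothing outside it. -/
instance finiteDimensional_truncSpace (Λ : Finset (UnitaryDual G)) :
    FiniteDimensional ℂ (truncSpace Λ) := by
  have hfd := fun π : UnitaryIrrep G => π.finiteDimensional
  let b := fun ν : UnitaryDual G => Module.finBasis ℂ (Quotient.out ν).E
  let S : Set (L2 G) := ⋃ ν ∈ Λ, Set.range fun p : Fin _ × Fin _ =>
    ContinuousMap.toLp 2 (haarProb G) ℂ (matrixCoeff (Quotient.out ν) (b ν p.1) (b ν p.2))
  have hS : S.Finite := Set.Finite.biUnion Λ.finite_toSet fun ν _ => Set.finite_range _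
  have hfin : FiniteDimensional ℂ (Submodule.span ℂ S) := FiniteDimensional.span_of_finite ℂ hS
  have hle : truncSpace Λ ≤ Submodule.span ℂ S := by
    refine Submodule.topologicalClosure_minimal _ (Submodule.span_le.2 ?_)
      (Submodule.closed_of_finiteDimensional _)
    rintro _ ⟨π, ξ, η, hπ, rfl⟩
    obtain ⟨e, he⟩ := Quotient.exact (Quotient.out_eq (Quotient.mk _ π : UnitaryDual G)).symm
    rw [matrixCoeff_of_equiv e he]
    refine Submodule.span_mono ?_ (matrixCoeff_mem_span _ (b (Quotient.mk _ π)) _ _)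
    exact Set.subset_biUnion_of_mem (u := fun ν : UnitaryDual G => Set.range fun p : Fin _ × Fin _ =>
      ContinuousMap.toLp 2 (haarProb G) ℂ (matrixCoeff (Quotient.out ν) (b ν p.1) (b ν p.2))) hπ
  exact Submodule.finiteDimensional_of_le hle

end FiniteDimensionality

/-! ### Optimal Lipschitz constants as seminorms. -/

section LipSup

variable {X E : Type*} [MetricSpace X] [NormedAddCommGroup E]

/-- The best Lipschitz constant of `F`, possibly infinite. -/
def lipSup (F : X → E) : ℝ≥0∞ :=
  ⨆ (x : X) (y : X) (_ : x ≠ y), ENNReal.ofReal (‖F x - F y‖ / dist x y)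

theorem lipSup_le_coe_iff {F : X → E} {K : ℝ≥0} : lipSup F ≤ K ↔ LipschitzWith K F := by
  simp only [lipSup, iSup_le_iff, lipschitzWith_iff_dist_le_mul, dist_eq_norm (F _)]
  refine forall₂_congr fun x y => ?_
  by_cases hxy : x = y
  · simp [hxy]
  · rw [ENNReal.ofReal_le_coe, div_le_iff₀ (dist_pos.2 hxy)]
    exact ⟨fun h => h hxy, fun h _ => h⟩

theorem lipschitzWith_lipSup {F : X → E} (h : lipSup F ≠ ∞) :
    LipschitzWith (lipSup F).toNNReal F :=
  lipSup_le_coe_iff.1 (ENNReal.coe_toNNReal h).ge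

theorem lipSup_add_le (F F' : X → E) : lipSup (fun x => F x + F' x) ≤ lipSup F + lipSup F' := by
  refine iSup₂_le fun x y => iSup_le fun hxy => ?_
  have hd := dist_pos.2 hxy
  calc ENNReal.ofReal (‖F x + F' x - (F y + F' y)‖ / dist x y)
      ≤ ENNReal.ofReal (‖F x - F y‖ / dist x y + ‖F' x - F' y‖ / dist x y) := by
        rw [add_sub_add_comm, ← add_div]
        gcongr
        exact norm_add_le _ _
    _ = ENNReal.ofReal (‖F x - F y‖ / dist x y) + ENNReal.ofReal (‖F' x - F' y‖ / dist x y) :=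
        ENNReal.ofReal_add (by positivity) (by positivity)
    _ ≤ _ := by
        gcongr
        · exact le_iSup₂_of_le x y (le_iSup_of_le hxy le_rfl)
        · exact le_iSup₂_of_le x y (le_iSup_of_le hxy le_rfl)

theorem lipSup_smul [NormedSpace ℝ E] (r : ℝ) (F : X → E) :
    lipSup (fun x => r • F x) = ENNReal.ofReal |r| * lipSup F := by
  simp only [lipSup, ENNReal.mul_iSup, ← smul_sub, norm_smul, Real.norm_eq_abs, mul_div_assoc,
    ENNReal.ofReal_mul (abs_nonneg r)]

theorem lipSup_eq_zero_iff {F : X → E} : lipSup F = 0 ↔ ∀ x y, F x = F y := by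
  rw [← nonpos_iff_eq_zero, ← ENNReal.coe_zero, lipSup_le_coe_iff, lipschitzWith_iff_dist_le_mul]
  simp

/-- The infimum of the Lipschitz constants is attained, at the supremum of the difference quotients.
-/
theorem lipNorm_eq_lipSup (f : LipAlg X) : lipNorm f = lipSup (f : C(X, ℝ)) := by
  refine le_antisymm ?_ (le_iInf₂ fun K hK => lipSup_le_coe_iff.2 hK)
  obtain ⟨K, hK⟩ := f.2
  have h : lipSup (f : C(X, ℝ)) ≠ ∞ :=
    ne_top_of_le_ne_top ENNReal.coe_ne_top (lipSup_le_coe_iff.2 hK)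
  exact (iInf₂_le (f := fun (K : ℝ≥0) (_ : LipschitzWith K (f : C(X, ℝ))) => (K : ℝ≥0∞)) _
    (lipschitzWith_lipSup h)).trans (ENNReal.coe_toNNReal h).le

end LipSup

/-! ### Translations, multiplication operators and their compressions. -/

section Multiplication

variable {G : Type u} [Group G] [MetricSpace G] [IsIsometricSMul G G] [IsIsometricSMul Gᵐᵒᵖ G]

/-- Left translation `x ↦ f (g x)`. -/
def leftTranslate (f : C(G, ℝ)) : C(G, C(G, ℝ)) :=
  ContinuousMap.curry ⟨fun p : G × G => f (p.1 * p.2), by fun_prop⟩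

/-- Right translation `x ↦ f (x g)`. -/
def rightTranslate (f : C(G, ℝ)) : C(G, C(G, ℝ)) :=
  ContinuousMap.curry ⟨fun p : G × G => f (p.2 * p.1), by fun_prop⟩

theorem leftTranslate_apply (f : C(G, ℝ)) (g x : G) : leftTranslate f g x = f (g * x) := rfl

theorem rightTranslate_apply (f : C(G, ℝ)) (g x : G) : rightTranslate f g x = f (x * g) := rfl

theorem LipschitzWith.rightTranslate {f : C(G, ℝ)} {K : ℝ≥0} (hf : LipschitzWith K f) (g : G) :
    LipschitzWith K (rightTranslate f g) :=
  LipschitzWith.of_dist_le_mul fun x y => by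
    simpa [rightTranslate_apply, dist_mul_right] using hf.dist_le_mul (x * g) (y * g)

variable [CompactSpace G]

theorem lipschitzWith_leftTranslate {f : C(G, ℝ)} {K : ℝ≥0} (hf : LipschitzWith K f) :
    LipschitzWith K (leftTranslate f) :=
  LipschitzWith.of_dist_le_mul fun x y => (ContinuousMap.dist_le (by positivity)).2 fun z => by
    simpa [leftTranslate_apply, dist_mul_right] using hf.dist_le_mul (x * z) (y * z)

theorem lipschitzWith_rightTranslate {f : C(G, ℝ)} {K : ℝ≥0} (hf : LipschitzWith K f) :
    LipschitzWith K (rightTranslate f) :=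
  LipschitzWith.of_dist_le_mul fun x y => (ContinuousMap.dist_le (by positivity)).2 fun z => by
    simpa [rightTranslate_apply, dist_mul_left] using hf.dist_le_mul (z * x) (z * y)

variable [MeasurableSpace G] [BorelSpace G]

theorem integral_leftTranslate_apply (f : C(G, ℝ)) (μ : Measure G) [IsFiniteMeasure μ] (z : G) :
    (∫ x, leftTranslate f x ∂μ) z = ∫ x, f (x * z) ∂μ :=
  (ContinuousLinearMap.integral_comp_comm (μ := μ) (ContinuousMap.evalCLM ℝ z)
    ((leftTranslate f).continuous.integrable_of_hasCompactSupport
      (HasCompactSupport.of_compactSpace _))).symm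

/-- At a point z the integrand is x ↦ f(zx), so left invariance of Haar measure makes the value
independent of z. -/
theorem integral_rightTranslate (f : C(G, ℝ)) :
    ∫ x, rightTranslate f x ∂haarProb G = (∫ x, f x ∂haarProb G) • (1 : C(G, ℝ)) := by
  ext z
  refine (ContinuousLinearMap.integral_comp_comm (μ := haarProb G) (ContinuousMap.evalCLM ℝ z)
    ((rightTranslate f).continuous.integrable_of_hasCompactSupport
      (HasCompactSupport.of_compactSpace _))).symm.trans ?_
  simpa [rightTranslate_apply] using integral_mul_left_eq_self (μ := haarProb G) f z

theorem coeFn_mulOp (f : C(G, ℝ)) (ψ : L2 G) :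
    mulOp f ψ =ᵐ[haarProb G] fun x => (f x : ℂ) * ψ x := by
  refine (ContinuousLinearMap.coeFn_holder _ _ _).trans ?_
  filter_upwards [ContinuousMap.coeFn_toLp (p := ∞) (𝕜 := ℂ) (haarProb G)
    ((⟨Complex.ofReal, Complex.continuous_ofReal⟩ : C(ℝ, ℂ)).comp f)] with x hx
  rw [hx]
  simp

theorem norm_mulOp_le (f : C(G, ℝ)) : ‖mulOp f‖ ≤ ‖f‖ := by
  refine ContinuousLinearMap.opNorm_le_bound _ (norm_nonneg f) fun ψ => ?_
  refine Lp.norm_le_mul_norm_of_ae_le_mul ?_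
  filter_upwards [coeFn_mulOp f ψ] with x hx
  rw [hx, norm_mul, Complex.norm_real]
  gcongr
  exact f.norm_coe_le_norm x

theorem isSelfAdjoint_mulOp (f : C(G, ℝ)) : IsSelfAdjoint (mulOp f) := by
  rw [ContinuousLinearMap.isSelfAdjoint_iff_isSymmetric]
  intro ψ φ
  change inner ℂ (mulOp f ψ) φ = inner ℂ ψ (mulOp f φ)
  rw [L2.inner_def, L2.inner_def]
  refine integral_congr_ae ?_
  filter_upwards [coeFn_mulOp f ψ, coeFn_mulOp f φ] with x h1 h2
  rw [h1, h2]
  simp only [RCLike.inner_apply, map_mul, Complex.conj_ofReal]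
  ring

theorem mulOp_mul (f g : C(G, ℝ)) : mulOp (f * g) = mulOp f ∘L mulOp g := by
  ext1 ψ
  apply Lp.ext
  filter_upwards [coeFn_mulOp (f * g) ψ, coeFn_mulOp f (mulOp g ψ), coeFn_mulOp g ψ] with x h1 h2 h3
  rw [h1, ContinuousLinearMap.comp_apply, h2, h3]
  simp [mul_assoc]

/-- Multiplication by f is the square of the self-adjoint operator of multiplication by √f. -/
theorem mulOp_nonneg {f : C(G, ℝ)} (hf : 0 ≤ f) : 0 ≤ mulOp f := by
  have h : f = (⟨fun x => √(f x), by fun_prop⟩ : C(G, ℝ)) * ⟨fun x => √(f x), by fun_prop⟩ := by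
    ext x
    exact (Real.mul_self_sqrt (hf x)).symm
  rw [h, mulOp_mul]
  exact (isSelfAdjoint_mulOp _).mul_self_nonneg

theorem mulOp_mono : Monotone (mulOp (G := G)) := fun f g h => by
  rw [← sub_nonneg, ← map_sub]
  exact mulOp_nonneg (sub_nonneg.2 h)

theorem coeFn_leftReg (g : G) (ψ : L2 G) :
    leftReg g ψ =ᵐ[haarProb G] fun x => ψ (g⁻¹ * x) :=
  Lp.coeFn_compMeasurePreserving ψ (measurePreserving_mul_left (haarProb G) g⁻¹)

theorem leftReg_mul_inv (g : G) : leftReg g ∘L leftReg g⁻¹ = ContinuousLinearMap.id ℂ (L2 G) := by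
  ext1 ψ
  apply Lp.ext
  refine (coeFn_leftReg g (leftReg g⁻¹ ψ)).trans ?_
  filter_upwards [(measurePreserving_mul_left (haarProb G) g⁻¹).quasiMeasurePreserving.ae
    (coeFn_leftReg g⁻¹ ψ)] with x hx
  simpa using hx

theorem norm_leftReg_apply (g : G) (ψ : L2 G) : ‖leftReg g ψ‖ = ‖ψ‖ :=
  (Lp.compMeasurePreservingₗᵢ ℂ (fun x : G => g⁻¹ * x)
    (measurePreserving_mul_left (haarProb G) g⁻¹)).norm_map ψ

theorem adjoint_leftReg (g : G) : ContinuousLinearMap.adjoint (leftReg g) = leftReg g⁻¹ := by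
  have h : ContinuousLinearMap.adjoint (leftReg g) ∘L leftReg g =
      ContinuousLinearMap.id ℂ (L2 G) :=
    (ContinuousLinearMap.norm_map_iff_adjoint_comp_self _).1 (norm_leftReg_apply g)
  calc ContinuousLinearMap.adjoint (leftReg g)
      = ContinuousLinearMap.adjoint (leftReg g) ∘L (leftReg g ∘L leftReg g⁻¹) := by
        rw [leftReg_mul_inv, ContinuousLinearMap.comp_id]
    _ = leftReg g⁻¹ := by
        rw [← ContinuousLinearMap.comp_assoc, h, ContinuousLinearMap.id_comp]

/-- Since (g⁻¹x)⁻¹ = x⁻¹g, the operator U_g only replaces η by π(g)η in a coefficient. -/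
theorem leftReg_mem_truncSpace (Λ : Finset (UnitaryDual G)) (g : G) {ψ : L2 G}
    (hψ : ψ ∈ truncSpace Λ) : leftReg g ψ ∈ truncSpace Λ := by
  refine map_mem_closure (leftReg g).continuous hψ fun φ hφ => ?_
  refine (Submodule.span_le (p := (Submodule.span ℂ _).comap (leftReg g).toLinearMap)).2 ?_ hφ
  rintro _ ⟨π, ξ, η, hπ, rfl⟩
  refine Submodule.subset_span ⟨π, ξ, (π.rep g : π.E →L[ℂ] π.E) η, hπ, ?_⟩
  apply Lp.ext
  refine (coeFn_leftReg g _).trans ?_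
  filter_upwards [(measurePreserving_mul_left (haarProb G) g⁻¹).quasiMeasurePreserving.ae
    (ContinuousMap.coeFn_toLp (p := 2) (𝕜 := ℂ) (haarProb G) (matrixCoeff π ξ η)),
    ContinuousMap.coeFn_toLp (p := 2) (𝕜 := ℂ) (haarProb G)
      (matrixCoeff π ξ ((π.rep g : π.E →L[ℂ] π.E) η))] with x hx hx'
  rw [hx, hx']
  simp only [matrixCoeff, ContinuousMap.coe_mk]
  rw [mul_inv_rev, inv_inv, UnitaryIrrep.rep_mul_apply]

/-- The truncated space is invariant under U_g and under its adjoint U_{g⁻¹}, hence so is its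
orthogonal complement. -/
theorem leftReg_comp_truncProj (Λ : Finset (UnitaryDual G)) (g : G) :
    leftReg g ∘L truncProj Λ = truncProj Λ ∘L leftReg g := by
  ext1 ψ
  refine (Submodule.eq_starProjection_of_mem_of_inner_eq_zero ?_ fun w hw => ?_).symm
  · exact leftReg_mem_truncSpace Λ g (Submodule.starProjection_apply_mem _ ψ)
  · change inner ℂ (leftReg g ψ - leftReg g (truncProj Λ ψ)) w = 0
    rw [← map_sub, ← ContinuousLinearMap.adjoint_inner_right, adjoint_leftReg]
    exact Submodule.starProjection_inner_eq_zero ψ _ (leftReg_mem_truncSpace Λ g⁻¹ hw)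

theorem leftReg_comp_mulOp (g : G) (f : C(G, ℝ)) :
    leftReg g ∘L mulOp f = mulOp (leftTranslate f g⁻¹) ∘L leftReg g := by
  ext1 ψ
  apply Lp.ext
  refine (coeFn_leftReg g _).trans ?_
  have hq := (measurePreserving_mul_left (haarProb G) g⁻¹).quasiMeasurePreserving
  filter_upwards [hq.ae (coeFn_mulOp f ψ), coeFn_mulOp (leftTranslate f g⁻¹) (leftReg g ψ),
    coeFn_leftReg g ψ] with x h1 h2 h3
  rw [ContinuousLinearMap.comp_apply, h2, h3, leftTranslate_apply]
  exact h1

/-- The map `f ↦ P_Λ f P_Λ` on continuous functions, as a bounded operator. -/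
def compressMul (Λ : Finset (UnitaryDual G)) : C(G, ℝ) →L[ℝ] (L2 G →L[ℂ] L2 G) :=
  (compress Λ ∘ₗ mulOp).mkContinuous 1 fun f => by
    have hP : ‖truncProj Λ‖ ≤ 1 := Submodule.starProjection_norm_le _
    calc ‖truncProj Λ ∘L mulOp f ∘L truncProj Λ‖
        ≤ ‖truncProj Λ‖ * (‖mulOp f‖ * ‖truncProj Λ‖) :=
          (ContinuousLinearMap.opNorm_comp_le _ _).trans
            (by gcongr; exact ContinuousLinearMap.opNorm_comp_le _ _)
      _ ≤ 1 * (‖f‖ * 1) := by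
          gcongr
          exact norm_mulOp_le f
      _ = 1 * ‖f‖ := by ring

theorem compressMul_apply (Λ : Finset (UnitaryDual G)) (f : C(G, ℝ)) :
    compressMul Λ f = truncProj Λ ∘L mulOp f ∘L truncProj Λ := rfl

theorem norm_compressMul_le (Λ : Finset (UnitaryDual G)) (f : C(G, ℝ)) :
    ‖compressMul Λ f‖ ≤ ‖f‖ := by
  simpa using (compressMul Λ).le_of_opNorm_le (LinearMap.mkContinuous_norm_le _ zero_le_one _) f

theorem compressMul_one (Λ : Finset (UnitaryDual G)) : compressMul Λ 1 = truncProj Λ := by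
  rw [compressMul_apply, mulOp_one, ContinuousLinearMap.id_comp]
  exact (truncSpace Λ).isIdempotentElem_starProjection

theorem isSelfAdjoint_truncProj (Λ : Finset (UnitaryDual G)) : IsSelfAdjoint (truncProj Λ) :=
  isSelfAdjoint_starProjection _

theorem isSelfAdjoint_compressMul (Λ : Finset (UnitaryDual G)) (f : C(G, ℝ)) :
    IsSelfAdjoint (compressMul Λ f) := by
  have h := (isSelfAdjoint_mulOp f).conjugate_self (isSelfAdjoint_truncProj Λ)
  rwa [mul_assoc] at h

theorem compress_mono (Λ : Finset (UnitaryDual G)) : Monotone (compress Λ) := fun S T h => by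
  have := IsSelfAdjoint.conjugate_le_conjugate h (isSelfAdjoint_truncProj Λ)
  rwa [mul_assoc, mul_assoc] at this

theorem compressMul_mono (Λ : Finset (UnitaryDual G)) : Monotone (compressMul Λ) := fun _ _ h =>
  compress_mono Λ (mulOp_mono h)

/-- Equivariance of the compression: U_g commutes with P_Λ and conjugates multiplication by f into
multiplication by its translate. -/
theorem lamAct_compressMul (Λ : Finset (UnitaryDual G)) (g : G) (f : C(G, ℝ)) :
    lamAct g (compressMul Λ f) = compressMul Λ (leftTranslate f g⁻¹) := by
  rw [lamAct, adjoint_leftReg, compressMul_apply, compressMul_apply]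
  have h1 := leftReg_comp_truncProj Λ g
  have h2 := leftReg_comp_mulOp g f
  have h3 := leftReg_mul_inv g
  ext1 ψ
  simp only [DFunLike.ext_iff, ContinuousLinearMap.comp_apply] at h1 h2 h3 ⊢
  rw [h1, h2, h1, h3, ContinuousLinearMap.id_apply]

theorem rhoAct_compressMul (Λ : Finset (UnitaryDual G)) (g : G) (f : C(G, ℝ)) :
    rhoAct g (compressMul Λ f) = compressMul Λ (rightTranslate f g) := by
  rw [rhoAct, adjoint_rightReg, compressMul_apply, compressMul_apply]
  have h1 := rightReg_comp_truncProj Λ g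
  have h2 : rightReg g ∘L mulOp f = mulOp (rightTranslate f g) ∘L rightReg g :=
    rightReg_comp_mulOp g f
  have h3 := rightReg_mul_inv g
  ext1 ψ
  simp only [DFunLike.ext_iff, ContinuousLinearMap.comp_apply] at h1 h2 h3 ⊢
  rw [h1, h2, h1, h3, ContinuousLinearMap.id_apply]

theorem lamNorm_eq_lipSup (T : L2 G →L[ℂ] L2 G) : lamNorm T = lipSup fun x => lamAct x T := rfl

theorem rhoNorm_eq_lipSup (T : L2 G →L[ℂ] L2 G) : rhoNorm T = lipSup fun x => rhoAct x T := rfl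

theorem LipschitzWith.lamNorm_compressMul_le (Λ : Finset (UnitaryDual G)) {f : C(G, ℝ)} {K : ℝ≥0}
    (hf : LipschitzWith K f) : lamNorm (compressMul Λ f) ≤ K := by
  rw [lamNorm_eq_lipSup, lipSup_le_coe_iff]
  refine LipschitzWith.of_dist_le_mul fun x y => ?_
  rw [lamAct_compressMul, lamAct_compressMul, dist_eq_norm, ← map_sub]
  refine (norm_compressMul_le Λ _).trans ?_
  rw [← dist_eq_norm, ← dist_inv_inv x y]
  exact (lipschitzWith_leftTranslate hf).dist_le_mul _ _

theorem LipschitzWith.rhoNorm_compressMul_le (Λ : Finset (UnitaryDual G)) {f : C(G, ℝ)} {K : ℝ≥0}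
    (hf : LipschitzWith K f) : rhoNorm (compressMul Λ f) ≤ K := by
  rw [rhoNorm_eq_lipSup, lipSup_le_coe_iff]
  refine LipschitzWith.of_dist_le_mul fun x y => ?_
  rw [rhoAct_compressMul, rhoAct_compressMul, dist_eq_norm, ← map_sub]
  refine (norm_compressMul_le Λ _).trans ?_
  rw [← dist_eq_norm]
  exact (lipschitzWith_rightTranslate hf).dist_le_mul _ _

theorem rhoAct_one_compressMul (Λ : Finset (UnitaryDual G)) (f : C(G, ℝ)) :
    rhoAct 1 (compressMul Λ f) = compressMul Λ f := by
  rw [rhoAct_compressMul]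
  congr 1
  ext x
  simp [rightTranslate_apply]

theorem lamAct_one_compressMul (Λ : Finset (UnitaryDual G)) (f : C(G, ℝ)) :
    lamAct 1 (compressMul Λ f) = compressMul Λ f := by
  rw [lamAct_compressMul]
  congr 1
  ext x
  simp [leftTranslate_apply]

/-- Averaging over the right translations replaces `f` by its mean. -/
theorem norm_compressMul_sub_mean_le (Λ : Finset (UnitaryDual G)) (f : C(G, ℝ)) {K : ℝ≥0}
    (hK : rhoNorm (compressMul Λ f) ≤ K) :
    ‖compressMul Λ f - (∫ x, f x ∂haarProb G) • truncProj Λ‖ ≤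
      K * Metric.diam (Set.univ : Set G) := by
  rw [rhoNorm_eq_lipSup, lipSup_le_coe_iff] at hK
  have hi : Integrable (rightTranslate f) (haarProb G) :=
    (rightTranslate f).continuous.integrable_of_hasCompactSupport
      (HasCompactSupport.of_compactSpace _)
  -- The mean of the right translates of f is a constant function, which compresses to a multiple of
  -- P_Λ.
  have h1 : compressMul Λ f - (∫ x, f x ∂haarProb G) • truncProj Λ =
      ∫ x, (compressMul Λ f - compressMul Λ (rightTranslate f x)) ∂haarProb G := by
    rw [integral_sub (integrable_const _) ((compressMul Λ).integrable_comp hi),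
      ContinuousLinearMap.integral_comp_comm _ hi, integral_rightTranslate, map_smul,
      compressMul_one]
    simp
  rw [h1]
  have h2 := norm_integral_le_of_norm_le_const (μ := haarProb G)
    (f := fun x => compressMul Λ f - compressMul Λ (rightTranslate f x))
    (C := K * Metric.diam (Set.univ : Set G)) (Filter.Eventually.of_forall fun x => by
      have := hK.dist_le_mul 1 x
      rw [rhoAct_one_compressMul, rhoAct_compressMul, dist_eq_norm] at this
      refine this.trans ?_
      gcongr
      exact Metric.dist_le_diam_of_mem (isCompact_univ.isBounded) trivial trivial)
  simpa using h2

/-- Averaging over the left translations with respect to `μ` moves `P_Λ f P_Λ` by at most the mean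
distance of `μ` from the identity. -/
theorem norm_compressMul_integral_leftTranslate_sub_le (Λ : Finset (UnitaryDual G)) (f : C(G, ℝ))
    (μ : Measure G) [IsProbabilityMeasure μ] {K : ℝ≥0} (hK : lamNorm (compressMul Λ f) ≤ K) :
    ‖compressMul Λ (∫ x, leftTranslate f x ∂μ) - compressMul Λ f‖ ≤ K * ∫ x, dist 1 x ∂μ := by
  rw [lamNorm_eq_lipSup, lipSup_le_coe_iff] at hK
  have hi : Integrable (leftTranslate f) μ :=
    (leftTranslate f).continuous.integrable_of_hasCompactSupport
      (HasCompactSupport.of_compactSpace _)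
  have hd : Integrable (fun x : G => dist 1 x) μ :=
    (continuous_const.dist continuous_id).integrable_of_hasCompactSupport
      (HasCompactSupport.of_compactSpace _)
  have h1 : compressMul Λ (∫ x, leftTranslate f x ∂μ) - compressMul Λ f =
      ∫ x, (compressMul Λ (leftTranslate f x) - compressMul Λ f) ∂μ := by
    rw [integral_sub ((compressMul Λ).integrable_comp hi) (integrable_const _),
      ContinuousLinearMap.integral_comp_comm _ hi]
    simp
  rw [h1, ← integral_const_mul]
  refine norm_integral_le_of_norm_le (hd.const_mul _) (Filter.Eventually.of_forall fun x => ?_)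
  -- Translation by x corresponds to λ at x⁻¹; inversion is an isometry, so the distance to 1 is
  -- unchanged.
  have := hK.dist_le_mul x⁻¹ 1
  rw [lamAct_one_compressMul, lamAct_compressMul, inv_inv, dist_eq_norm] at this
  rwa [← dist_inv_inv, inv_inv, inv_one, dist_comm x] at this

end Multiplication

/-! ### Auxiliary facts on order units and finite nets. -/

theorem Submodule.orderUnitSpace {M : Type*} [AddCommGroup M] [PartialOrder M]
    [IsOrderedAddMonoid M] [Module ℝ M] [IsOrderedModule ℝ M] (S : Submodule ℝ M) [One S]
    (exists_le : ∀ a : S, ∃ r : ℝ, (a : M) ≤ r • ((1 : S) : M))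
    (le_zero : ∀ a : S, (∀ r : ℝ, 0 < r → (a : M) ≤ r • ((1 : S) : M)) → (a : M) ≤ 0) :
    OrderUnitSpace S where
  toIsOrderedAddMonoid := inferInstance
  toIsOrderedModule := IsOrderedModule.of_smul_nonneg fun r hr a ha =>
    show (0 : M) ≤ r • (a : M) from smul_nonneg hr ha
  exists_le_smul_one := exists_le
  le_zero_of_forall_le_smul_one := le_zero

theorem IsSelfAdjoint.le_complex_smul_one {H : Type*} [NormedAddCommGroup H]
    [InnerProductSpace ℂ H] [CompleteSpace H] {T : H →L[ℂ] H} (hT : IsSelfAdjoint T) {r : ℝ}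
    (h : ‖T‖ ≤ r) : T ≤ (r : ℂ) • (1 : H →L[ℂ] H) := by
  refine hT.le_algebraMap_norm_self.trans ?_
  rw [Algebra.algebraMap_eq_smul_one, Complex.coe_smul]
  exact smul_le_smul_of_nonneg_right h zero_le_one

theorem exists_finite_net_closedBall (E : Type*) [NormedAddCommGroup E] [NormedSpace ℝ E]
    [FiniteDimensional ℝ E] (R : ℝ) {ε : ℝ} (hε : 0 < ε) :
    ∃ t : Set E, t.Finite ∧ ∀ x, ‖x‖ ≤ R → ∃ b ∈ t, ‖x - b‖ < ε := by
  have : ProperSpace E := FiniteDimensional.proper ℝ E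
  obtain ⟨t, -, htfin, ht⟩ := finite_cover_balls_of_compact (isCompact_closedBall (0 : E) R) hε
  refine ⟨t, htfin, fun x hx => ?_⟩
  obtain ⟨b, hb, hxb⟩ := Set.mem_iUnion₂.1 (ht (mem_closedBall_zero_iff.2 hx))
  exact ⟨b, hb, mem_ball_iff_norm.1 hxb⟩

/-! ### The quantum metric space of Lipschitz functions. -/

section LipschitzFunctions

variable {X : Type*} [MetricSpace X]

namespace LipAlg

theorem coe_one : ((1 : LipAlg X) : C(X, ℝ)) = 1 := rfl

theorem orderBounded_iff {f : LipAlg X} {r : ℝ} :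
    OrderBounded f r ↔ ∀ x, |(f : C(X, ℝ)) x| ≤ r := by
  have h1 : f ≤ r • (1 : LipAlg X) ↔ ∀ x, (f : C(X, ℝ)) x ≤ r := by
    rw [← Subtype.coe_le_coe, ContinuousMap.le_def]
    simp [coe_one]
  have h2 : -f ≤ r • (1 : LipAlg X) ↔ ∀ x, -(f : C(X, ℝ)) x ≤ r := by
    rw [← Subtype.coe_le_coe, ContinuousMap.le_def]
    simp [coe_one]
  rw [OrderBounded, h1, h2, ← forall_and]
  refine forall_congr' fun x => ?_
  rw [abs_le']

theorem lipschitzWith_of_lipNorm_le {f : LipAlg X} {K : ℝ≥0} (h : lipNorm f ≤ K) :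
    LipschitzWith K (f : C(X, ℝ)) := by
  rwa [lipNorm_eq_lipSup, lipSup_le_coe_iff] at h

/-- The evaluation state at a point. -/
def evalState (x : X) : State (LipAlg X) where
  toFun f := (f : C(X, ℝ)) x
  map_add' _ _ := rfl
  map_smul' _ _ := rfl
  monotone' _ _ h := h x
  map_one' := rfl

variable [CompactSpace X]

theorem orderUnitSpace : OrderUnitSpace (LipAlg X) := by
  refine (LipAlg X).orderUnitSpace (fun f => ⟨‖(f : C(X, ℝ))‖, ?_⟩) fun f hf => ?_
  · rw [coe_one, ContinuousMap.le_def]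
    intro x
    simpa using (f : C(X, ℝ)).apply_le_norm x
  · rw [ContinuousMap.le_def]
    refine fun x => le_of_forall_pos_le_add fun r hr => ?_
    simpa [coe_one] using (ContinuousMap.le_def.1 (hf r hr)) x

/-- Arzelà–Ascoli: subtract the value at a base point o, which is free modulo constants, and sample
on a finite ε/3-net of X. The samples lie in a bounded subset of a finite-dimensional space, and
1-Lipschitz functions are determined by them up to error. -/
theorem lipBallTotallyBounded [Nonempty X] : LipBallTotallyBounded (lipNorm (G := X)) := by
  intro ε hε
  let o : X := Classical.arbitrary X
  obtain ⟨t, -, htfin, ht⟩ :=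
    finite_cover_balls_of_compact (isCompact_univ : IsCompact (Set.univ : Set X))
      (show 0 < ε / 3 by positivity)
  have : Fintype t := htfin.fintype
  let Φ : LipAlg X → t → ℝ := fun f z => (f : C(X, ℝ)) z - (f : C(X, ℝ)) o
  have hlip : ∀ f : LipAlg X, lipNorm f ≤ 1 → ∀ x y,
      |(f : C(X, ℝ)) x - (f : C(X, ℝ)) y| ≤ dist x y := fun f hf x y => by
    have := (lipschitzWith_of_lipNorm_le (K := 1) (by simpa using hf)).dist_le_mul x y
    simpa [Real.dist_eq] using this
  have hbdd : TotallyBounded (Φ '' {f | lipNorm f ≤ 1}) := by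
    refine (isCompact_closedBall (0 : t → ℝ)
      (Metric.diam (Set.univ : Set X))).totallyBounded.subset ?_
    rintro _ ⟨f, hf, rfl⟩
    rw [mem_closedBall_zero_iff, pi_norm_le_iff_of_nonneg Metric.diam_nonneg]
    exact fun z => (hlip f hf z o).trans
      (Metric.dist_le_diam_of_mem isCompact_univ.isBounded trivial trivial)
  -- The net is taken inside the image of the ball, so its members b are themselves 1-Lipschitz; the
  -- final error is three times ε/3.
  obtain ⟨F, hF, hFfin, hcov⟩ := Set.exists_subset_image_finite_and.1
    (Metric.finite_approx_of_totallyBounded hbdd (ε / 3) (by positivity))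
  refine ⟨F, hFfin, fun f hf => ?_⟩
  obtain ⟨_, ⟨b, hb, rfl⟩, hfb⟩ := Set.mem_iUnion₂.1 (hcov (Set.mem_image_of_mem Φ hf))
  refine ⟨b, hb, (f : C(X, ℝ)) o - (b : C(X, ℝ)) o, orderBounded_iff.2 fun x => ?_⟩
  obtain ⟨z, hz, hxz⟩ := Set.mem_iUnion₂.1 (ht (Set.mem_univ x))
  have h1 := (hlip f hf x z).trans (Metric.mem_ball.1 hxz).le
  have h2 := (hlip b (hF hb) x z).trans (Metric.mem_ball.1 hxz).le
  have h3 : |Φ f ⟨z, hz⟩ - Φ b ⟨z, hz⟩| ≤ ε / 3 :=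
    (dist_le_pi_dist (Φ f) (Φ b) ⟨z, hz⟩).trans (Metric.mem_ball.1 hfb).le
  simp only [Φ] at h3
  simp only [Submodule.coe_sub, Submodule.coe_smul, coe_one, ContinuousMap.sub_apply,
    ContinuousMap.smul_apply, ContinuousMap.one_apply, smul_eq_mul, mul_one]
  rw [abs_le] at *
  constructor <;> linarith [h1.1, h1.2, h2.1, h2.2, h3.1, h3.2]

theorem isQuantumMetricSpace [Nonempty X] : IsQuantumMetricSpace (lipNorm (G := X)) := by
  refine ⟨orderUnitSpace, IsLipNorm.of_totallyBounded (fun f => ?_) (fun f g => ?_)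
    (fun r f => ?_) (fun f => ?_) lipBallTotallyBounded⟩
  · obtain ⟨K, hK⟩ := f.2
    exact ne_top_of_le_ne_top ENNReal.coe_ne_top (iInf₂_le K hK)
  · simp only [lipNorm_eq_lipSup]
    exact lipSup_add_le _ _
  · simp only [lipNorm_eq_lipSup]
    exact lipSup_smul _ _
  · rw [lipNorm_eq_lipSup, lipSup_eq_zero_iff]
    constructor
    · refine fun h => ⟨(f : C(X, ℝ)) (Classical.arbitrary X), Subtype.ext (ContinuousMap.ext fun x => ?_)⟩
      simp [coe_one, h x (Classical.arbitrary X)]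
    · rintro ⟨r, rfl⟩ x y
      simp [coe_one]

end LipAlg

end LipschitzFunctions

/-! ### The truncated algebra as a quantum metric space, and the symbol map. -/

section Truncation

variable {G : Type u} [Group G] [MetricSpace G] [IsIsometricSMul G G] [IsIsometricSMul Gᵐᵒᵖ G]
  [CompactSpace G] [MeasurableSpace G] [BorelSpace G]

theorem coe_trunc (Λ : Finset (UnitaryDual G)) (f : LipAlg G) :
    (trunc Λ f : L2 G →L[ℂ] L2 G) = compressMul Λ f := rfl

theorem trunc_surjective (Λ : Finset (UnitaryDual G)) : Function.Surjective (trunc Λ) := by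
  rintro ⟨_, f, hf, rfl⟩
  exact ⟨⟨f, hf⟩, rfl⟩

theorem rhoAct_add (g : G) (S T : L2 G →L[ℂ] L2 G) :
    rhoAct g (S + T) = rhoAct g S + rhoAct g T := by
  ext1
  simp [rhoAct]

theorem rhoAct_smul (g : G) (r : ℝ) (T : L2 G →L[ℂ] L2 G) :
    rhoAct g (r • T) = r • rhoAct g T := by
  ext1
  simp [rhoAct]

theorem lamAct_add (g : G) (S T : L2 G →L[ℂ] L2 G) :
    lamAct g (S + T) = lamAct g S + lamAct g T := by
  ext1
  simp [lamAct]

theorem lamAct_smul (g : G) (r : ℝ) (T : L2 G →L[ℂ] L2 G) :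
    lamAct g (r • T) = r • lamAct g T := by
  ext1
  simp [lamAct]

theorem real_smul_eq_complex_smul (r : ℝ) (T : L2 G →L[ℂ] L2 G) : r • T = (r : ℂ) • T := by
  ext1 ψ
  exact (Complex.coe_smul r (T ψ)).symm

instance isOrderedModule_clm_L2 : IsOrderedModule ℝ (L2 G →L[ℂ] L2 G) :=
  IsOrderedModule.of_smul_nonneg fun r hr T hT => by
    rw [ContinuousLinearMap.nonneg_iff_isPositive] at hT ⊢
    rw [real_smul_eq_complex_smul]
    exact hT.smul_of_nonneg (Complex.zero_le_real.2 hr)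

theorem rhoAct_mono (g : G) : Monotone (rhoAct g) := fun S T h => by
  rw [ContinuousLinearMap.le_def] at h ⊢
  have := h.conj_adjoint (rightReg g)
  rw [sub_eq_add_neg, ← neg_one_smul ℝ S] at this
  have h2 := rhoAct_add g T ((-1 : ℝ) • S)
  rw [rhoAct_smul, neg_one_smul ℝ (rhoAct g S), ← sub_eq_add_neg] at h2
  rw [← h2]
  exact this

theorem compress_compressMul (Λ : Finset (UnitaryDual G)) (f : C(G, ℝ)) :
    compress Λ (compressMul Λ f) = compressMul Λ f := by
  have h : truncProj Λ * truncProj Λ = truncProj Λ :=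
    (truncSpace Λ).isIdempotentElem_starProjection
  change truncProj Λ * ((truncProj Λ * (mulOp f * truncProj Λ)) * truncProj Λ) =
    truncProj Λ * (mulOp f * truncProj Λ)
  rw [mul_assoc, mul_assoc, h, ← mul_assoc, h]

theorem compress_one (Λ : Finset (UnitaryDual G)) : compress Λ 1 = truncProj Λ :=
  (truncSpace Λ).isIdempotentElem_starProjection

namespace TruncAlg

variable (Λ : Finset (UnitaryDual G))

theorem trunc_one : trunc Λ 1 = 1 := Subtype.ext (compressMul_one Λ)

/-- The order unit is P_Λ rather than the identity of L²(G), so the usual bound T ≤ r • id is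
compressed by P_Λ, which fixes T. -/
theorem le_smul_one_of_norm_le {T : TruncAlg Λ} {r : ℝ} (h : ‖(T : L2 G →L[ℂ] L2 G)‖ ≤ r) :
    T ≤ r • (1 : TruncAlg Λ) := by
  obtain ⟨f, rfl⟩ := trunc_surjective Λ T
  rw [coe_trunc] at h
  have h1 : compressMul Λ (f : C(G, ℝ)) ≤ r • (1 : L2 G →L[ℂ] L2 G) := by
    rw [real_smul_eq_complex_smul]
    exact (isSelfAdjoint_compressMul Λ (f : C(G, ℝ))).le_complex_smul_one h
  have h2 := compress_mono Λ h1
  rwa [compress_compressMul, map_smul, compress_one] at h2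

theorem orderBounded_of_norm_le {T : TruncAlg Λ} {r : ℝ} (h : ‖(T : L2 G →L[ℂ] L2 G)‖ ≤ r) :
    OrderBounded T r :=
  ⟨le_smul_one_of_norm_le Λ h, le_smul_one_of_norm_le Λ (by simpa using h)⟩

theorem orderUnitSpace : OrderUnitSpace (TruncAlg Λ) := by
  refine (TruncAlg Λ).orderUnitSpace
    (fun T => ⟨‖(T : L2 G →L[ℂ] L2 G)‖, le_smul_one_of_norm_le Λ le_rfl⟩) fun T hT => ?_
  have hlim : Filter.Tendsto (fun r : ℝ => r • ((1 : TruncAlg Λ) : L2 G →L[ℂ] L2 G))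
      (nhdsWithin 0 (Set.Ioi 0)) (nhds 0) := by
    have : Continuous fun r : ℝ => r • ((1 : TruncAlg Λ) : L2 G →L[ℂ] L2 G) := by fun_prop
    simpa using (this.tendsto 0).mono_left nhdsWithin_le_nhds
  -- The positive cone is closed in norm, so the bounds pass to the limit r → 0.
  exact ge_of_tendsto hlim (eventually_nhdsWithin_of_forall hT)

/-- Every compression factors through the finite-dimensional truncated space, so the algebra lies in
the image of its endomorphisms. -/
theorem finiteDimensional : FiniteDimensional ℝ (TruncAlg Λ) := by
  let V := truncSpace Λ
  let Ψ : (V →ₗ[ℂ] V) →ₗ[ℝ] (L2 G →L[ℂ] L2 G) :=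
    { toFun := fun S => V.subtypeL ∘L LinearMap.toContinuousLinearMap S ∘L V.orthogonalProjectionOnto
      map_add' := fun S T => by ext1; simp
      map_smul' := fun r S => by ext1; simp }
  have hfd : FiniteDimensional ℝ (V →ₗ[ℂ] V) := Module.Finite.trans ℂ _
  have hle : TruncAlg Λ ≤ LinearMap.range Ψ := by
    rintro _ ⟨f, -, rfl⟩
    exact ⟨(V.orthogonalProjectionOnto ∘L mulOp f ∘L V.subtypeL).toLinearMap, rfl⟩
  exact Submodule.finiteDimensional_of_le hle

theorem truncLipNorm_trunc_le (f : LipAlg G) : truncLipNorm Λ (trunc Λ f) ≤ lipNorm f :=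
  le_iInf₂ fun _ hK => max_le (hK.lamNorm_compressMul_le Λ) (hK.rhoNorm_compressMul_le Λ)

theorem truncLipNorm_add_le (S T : TruncAlg Λ) :
    truncLipNorm Λ (S + T) ≤ truncLipNorm Λ S + truncLipNorm Λ T := by
  refine max_le ?_ ?_
  · refine le_trans ?_ (add_le_add (le_max_left _ _) (le_max_left _ _))
    simp only [lamNorm_eq_lipSup, Submodule.coe_add, lamAct_add]
    exact lipSup_add_le _ _
  · refine le_trans ?_ (add_le_add (le_max_right _ _) (le_max_right _ _))
    simp only [rhoNorm_eq_lipSup, Submodule.coe_add, rhoAct_add]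
    exact lipSup_add_le _ _

theorem truncLipNorm_smul (r : ℝ) (T : TruncAlg Λ) :
    truncLipNorm Λ (r • T) = ENNReal.ofReal |r| * truncLipNorm Λ T := by
  rw [truncLipNorm, truncLipNorm, mul_max]
  simp only [lamNorm_eq_lipSup, rhoNorm_eq_lipSup, Submodule.coe_smul, lamAct_smul, rhoAct_smul,
    lipSup_smul]

/-- Serves twice: with K = 0 it identifies the kernel of L_Λ, and with K = 1 it bounds the unit ball
modulo scalars. -/
theorem exists_norm_sub_smul_one_le (T : TruncAlg Λ) {K : ℝ≥0} (hT : truncLipNorm Λ T ≤ K) :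
    ∃ r : ℝ, ‖((T - r • (1 : TruncAlg Λ) : TruncAlg Λ) : L2 G →L[ℂ] L2 G)‖ ≤
      K * Metric.diam (Set.univ : Set G) := by
  obtain ⟨f, rfl⟩ := trunc_surjective Λ T
  exact ⟨_, norm_compressMul_sub_mean_le Λ f ((le_max_right _ _).trans hT)⟩

theorem truncLipNorm_eq_zero_iff (T : TruncAlg Λ) :
    truncLipNorm Λ T = 0 ↔ ∃ r : ℝ, T = r • (1 : TruncAlg Λ) := by
  constructor
  · intro h
    obtain ⟨r, hr⟩ := exists_norm_sub_smul_one_le Λ T (K := 0) (by simpa using h.le)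
    refine ⟨r, sub_eq_zero.1 (Subtype.ext (norm_le_zero_iff.1 ?_))⟩
    simpa using hr
  · rintro ⟨r, rfl⟩
    have h1 : truncLipNorm Λ 1 = 0 := by
      rw [← trunc_one, ← nonpos_iff_eq_zero]
      exact (truncLipNorm_trunc_le Λ 1).trans
        (((LipAlg.isQuantumMetricSpace).isLipNorm.eq_zero_iff 1).2 ⟨1, by simp⟩).le
    rw [truncLipNorm_smul, h1, mul_zero]

theorem lipBallTotallyBounded : LipBallTotallyBounded (truncLipNorm Λ) := by
  intro ε hε
  have := finiteDimensional Λ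
  obtain ⟨t, htfin, ht⟩ :=
    exists_finite_net_closedBall (TruncAlg Λ) (Metric.diam (Set.univ : Set G)) hε
  refine ⟨t, htfin, fun T hT => ?_⟩
  obtain ⟨r, hr⟩ := exists_norm_sub_smul_one_le Λ T (K := 1) (hT.trans_eq ENNReal.coe_one.symm)
  obtain ⟨b, hb, hTb⟩ := ht (T - r • (1 : TruncAlg Λ)) (hr.trans_eq (one_mul _))
  refine ⟨b, hb, r, orderBounded_of_norm_le Λ ?_⟩
  rw [sub_right_comm T b (r • (1 : TruncAlg Λ))]
  exact hTb.le

theorem isQuantumMetricSpace : IsQuantumMetricSpace (truncLipNorm Λ) := by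
  refine ⟨orderUnitSpace Λ, IsLipNorm.of_totallyBounded (fun T => ?_) (truncLipNorm_add_le Λ)
    (truncLipNorm_smul Λ) (truncLipNorm_eq_zero_iff Λ) (lipBallTotallyBounded Λ)⟩
  obtain ⟨f, rfl⟩ := trunc_surjective Λ T
  exact ne_top_of_le_ne_top (LipAlg.isQuantumMetricSpace.isLipNorm.ne_top f)
    (truncLipNorm_trunc_le Λ f)

end TruncAlg

variable (Λ : Finset (UnitaryDual G))

/-- The compression map `τ_Λ` as an order-unit morphism. -/
def truncHom : OrderUnitHom (LipAlg G) (TruncAlg Λ) where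
  toFun := trunc Λ
  map_add' f g := Subtype.ext ((compressMul Λ).map_add f g)
  map_smul' r f := Subtype.ext ((compressMul Λ).map_smul r (f : C(G, ℝ)))
  monotone' _ _ h := compressMul_mono Λ h
  map_one' := TruncAlg.trunc_one Λ

theorem truncRho_trunc (g : G) (f : LipAlg G) :
    truncRho Λ g (trunc Λ f) = trunc Λ ⟨rightTranslate f g, f.2.imp fun _ hK => hK.rightTranslate g⟩ :=
  Subtype.ext (rhoAct_compressMul Λ g f)

theorem truncRho_one (g : G) : truncRho Λ g 1 = 1 := by
  rw [← TruncAlg.trunc_one, truncRho_trunc]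
  rfl

/-- A state is contractive for the operator norm, because norm bounds give order bounds by multiples
of P_Λ. -/
theorem lipschitzWith_state_truncRho (σ : State (TruncAlg Λ)) (T : TruncAlg Λ) {K : ℝ≥0}
    (hK : rhoNorm (T : L2 G →L[ℂ] L2 G) ≤ K) :
    LipschitzWith K fun g => σ (truncRho Λ g T) := by
  rw [rhoNorm_eq_lipSup, lipSup_le_coe_iff] at hK
  refine LipschitzWith.of_dist_le_mul fun g h => ?_
  rw [Real.dist_eq, ← σ.map_sub]
  refine σ.abs_le (TruncAlg.orderBounded_of_norm_le Λ ?_)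
  have := hK.dist_le_mul g h
  rwa [dist_eq_norm] at this

theorem rhoNorm_ne_top (T : TruncAlg Λ) : rhoNorm (T : L2 G →L[ℂ] L2 G) ≠ ∞ :=
  ne_top_of_le_ne_top ((TruncAlg.isQuantumMetricSpace Λ).isLipNorm.ne_top T) (le_max_right _ _)

/-- The order-unit morphism `T ↦ (g ↦ σ (ρ_g T))`. -/
def covariantSymbol (σ : State (TruncAlg Λ)) : OrderUnitHom (TruncAlg Λ) (LipAlg G) where
  toFun T := ⟨⟨fun g => σ (truncRho Λ g T), (lipschitzWith_state_truncRho Λ σ T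
      (ENNReal.coe_toNNReal (rhoNorm_ne_top Λ T)).ge).continuous⟩,
    _, lipschitzWith_state_truncRho Λ σ T (ENNReal.coe_toNNReal (rhoNorm_ne_top Λ T)).ge⟩
  map_add' S T := by
    ext g
    change σ (truncRho Λ g (S + T)) = σ (truncRho Λ g S) + σ (truncRho Λ g T)
    rw [← σ.map_add]
    exact congrArg σ (Subtype.ext (rhoAct_add g _ _))
  map_smul' r T := by
    ext g
    change σ (truncRho Λ g (r • T)) = r • σ (truncRho Λ g T)
    rw [← σ.map_smul]
    exact congrArg σ (Subtype.ext (rhoAct_smul g r _))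
  monotone' _ _ h g := σ.mono (rhoAct_mono g h)
  map_one' := by
    ext g
    change σ (truncRho Λ g 1) = 1
    rw [truncRho_one, σ.map_one]

theorem covariantSymbol_apply (σ : State (TruncAlg Λ)) (T : TruncAlg Λ) (g : G) :
    (covariantSymbol Λ σ T : C(G, ℝ)) g = σ (truncRho Λ g T) := rfl

theorem isLipMorphism_covariantSymbol (σ : State (TruncAlg Λ)) :
    (covariantSymbol Λ σ).IsLipMorphism (truncLipNorm Λ) lipNorm := fun T => by
  have h : rhoNorm (T : L2 G →L[ℂ] L2 G) ≤ (rhoNorm (T : L2 G →L[ℂ] L2 G)).toNNReal :=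
    (ENNReal.coe_toNNReal (rhoNorm_ne_top Λ T)).ge
  calc lipNorm (covariantSymbol Λ σ T)
      ≤ (rhoNorm (T : L2 G →L[ℂ] L2 G)).toNNReal := by
        rw [lipNorm_eq_lipSup, lipSup_le_coe_iff]
        exact lipschitzWith_state_truncRho Λ σ T h
    _ = rhoNorm (T : L2 G →L[ℂ] L2 G) := ENNReal.coe_toNNReal (rhoNorm_ne_top Λ T)
    _ ≤ truncLipNorm Λ T := le_max_right _ _

/-- Conjugation by V_g turns f into x ↦ f(xg), which the lifted state integrates against μ. Read as
a function of g, the result is an average of left translates. -/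
theorem IsLift.covariantSymbol_trunc {Λ : Finset (UnitaryDual G)} {μ : Measure G}
    [IsProbabilityMeasure μ] {σ : State (TruncAlg Λ)} (hσ : IsLift Λ μ σ) (f : LipAlg G) :
    (covariantSymbol Λ σ (trunc Λ f) : C(G, ℝ)) = ∫ x, leftTranslate (f : C(G, ℝ)) x ∂μ := by
  ext g
  rw [covariantSymbol_apply, truncRho_trunc, hσ, integral_leftTranslate_apply]
  rfl

/-- Right invariance gives d(xg, g) = d(x, e), uniformly in g. -/
theorem abs_integral_leftTranslate_sub_le {f : C(G, ℝ)} {K : ℝ≥0} (hf : LipschitzWith K f)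
    (μ : Measure G) [IsProbabilityMeasure μ] (g : G) :
    |(∫ x, leftTranslate f x ∂μ) g - f g| ≤ K * ∫ x, dist 1 x ∂μ := by
  have hi : Integrable (fun x => f (x * g)) μ :=
    (f.continuous.comp (continuous_mul_const g)).integrable_of_hasCompactSupport
      (HasCompactSupport.of_compactSpace _)
  have hd : Integrable (fun x : G => dist 1 x) μ :=
    (continuous_const.dist continuous_id).integrable_of_hasCompactSupport
      (HasCompactSupport.of_compactSpace _)
  have h1 : (∫ x, leftTranslate f x ∂μ) g - f g = ∫ x, (f (x * g) - f g) ∂μ := by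
    rw [integral_leftTranslate_apply, integral_sub hi (integrable_const _)]
    simp
  rw [h1, ← Real.norm_eq_abs, ← integral_const_mul]
  refine norm_integral_le_of_norm_le (hd.const_mul _) (Filter.Eventually.of_forall fun x => ?_)
  have := hf.dist_le_mul (x * g) (1 * g)
  rwa [dist_mul_right, one_mul, dist_eq_norm, dist_comm x] at this

end Truncation

end

/-! ### The main estimate. -/

theorem proposition4p3 {G : Type u} [Group G] [MetricSpace G] [CompactSpace G]
    [IsIsometricSMul G G] [IsIsometricSMul Gᵐᵒᵖ G] [MeasurableSpace G] [BorelSpace G]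
    (Λ : Finset (UnitaryDual G)) (μ : Measure G) [IsProbabilityMeasure μ]
    (μΛ : State (TruncAlg Λ)) (hμ : IsLift Λ μ μΛ) :
    ∃ (hΛ : IsQuantumMetricSpace (truncLipNorm Λ))
      (hG : IsQuantumMetricSpace (lipNorm (G := G)))
      (_ : Nonempty (State (TruncAlg Λ))) (_ : Nonempty (State (LipAlg G))),
      (∃ υ : OrderUnitHom (TruncAlg Λ) (LipAlg G),
        (∀ (T : TruncAlg Λ) (g : G), (υ T : C(G, ℝ)) g = μΛ (truncRho Λ g T)) ∧
          υ.IsLipMorphism (truncLipNorm Λ) lipNorm) ∧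
      GromovHausdorff.ghDist (StateSpace hΛ) (StateSpace hG) ≤ ∫ x, dist 1 x ∂μ := by
  refine ⟨TruncAlg.isQuantumMetricSpace Λ, LipAlg.isQuantumMetricSpace, ⟨μΛ⟩, ⟨LipAlg.evalState 1⟩,
    ⟨covariantSymbol Λ μΛ, fun _ _ => rfl, isLipMorphism_covariantSymbol Λ μΛ⟩, ?_⟩
  have : Nonempty (State (TruncAlg Λ)) := ⟨μΛ⟩
  have : Nonempty (State (LipAlg G)) := ⟨LipAlg.evalState 1⟩
  refine ghDist_stateSpace_le _ _ (isLipMorphism_covariantSymbol Λ μΛ) (ψ := truncHom Λ)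
    (TruncAlg.truncLipNorm_trunc_le Λ) (integral_nonneg fun _ => dist_nonneg)
    (fun T hT => ?_) fun f hf => ?_
  -- On A_Λ, only the λ seminorm of T = P f P is used; f is an arbitrary preimage with no control on
  -- its Lipschitz constant.
  · obtain ⟨f, rfl⟩ := trunc_surjective Λ T
    refine TruncAlg.orderBounded_of_norm_le Λ ?_
    have h := norm_compressMul_integral_leftTranslate_sub_le Λ (f : C(G, ℝ)) μ (K := 1)
      ((le_max_left _ _).trans (hT.trans_eq ENNReal.coe_one.symm))
    rw [← hμ.covariantSymbol_trunc, NNReal.coe_one, one_mul] at h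
    exact h
  · refine LipAlg.orderBounded_iff.2 fun g => ?_
    have h := abs_integral_leftTranslate_sub_le
      (LipAlg.lipschitzWith_of_lipNorm_le (f := f) (K := 1) (by simpa using hf)) μ g
    rw [← hμ.covariantSymbol_trunc, NNReal.coe_one, one_mul] at h
    exact h
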